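/- **Setting.** Let $k\ge 2$, let $\mathcal A_1,\dots,\mathcal A_k$ be finite alphabets with at least two letters, and let $\pi_i:\mathcal A_i\to\mathcal A_{i+1}$ ($1\le i\le k-1$) be surjective maps. For $i\le j$ put $\Pi_{i,j}=\pi_{j-1}\circ\cdots\circ\pi_i$ (the identity if $i=j$) and $\Pi_i=\Pi_{1,i}$; these maps act letter by letter on the one-sided sequence spaces $X_i=\mathcal A_i^{\mathbb N^*}$, and $T_i$ is the shift on $X_i$. Let $\gamma_1>0$ and $\gamma_2,\dots,\gamma_k\ge 0$, and equip $X_1$ with the ultrametric $$d(x,y)=\max_{1\le i\le k} \exp\Big(-\frac{|\Pi_i(x)\wedge\Pi_i(y)|}{\gamma_1+\cdots+\gamma_i}\Big),$$ where $|u\wedge v|\in\{0,1,\dots,\infty\}$ is the length of the longest common prefix of $u$ and $v$ (with $e^{-\infty}=0$). Hausdorff dimension $\dim_H$ is taken with respect to $d$. Let $A$ be a random subset of $\mathcal A_1$ with $\mathbb E(\#A)>1$, let $(A(u))$ be independent copies of $A$ indexed by the finite words $u$ over $\mathcal A_1$ (including the empty word), and let $$K=\{x\in X_1:\ x_n\in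 A(x_1\cdots x_{n-1})\text{ for all } n\ge 1\}.$$ For $1\le i\le k$ and $b\in\mathcal A_i$ let $N^{(i)}_b=\#\{a\in A:\Pi_i(a)=b\}$, let $\widetilde{\mathcal A}_i=\{b\in\mathcal A_i:\mathbb E(N_b^{(i)})>0\}$, let $\widetilde X_i=\widetilde{\mathcal A}_i^{\,\mathbb N^*}$, and let $\mathcal M(\widetilde X_i,T_i)$ be the set of shift-invariant Borel probability measures on $\widetilde X_i$. For $2\le i\le k$ and $\theta\in\mathbb R$ put $$P_i(\theta)=\sup_{\nu\in\mathcal M(\widetilde X_i,T_i)}\Big\{\theta\,(\gamma_1+\cdots+\gamma_i)\int_{\widetilde X_i}\log\mathbb E\big(N^{(i)}_{x_1}\big)\,\mathrm d\nu(x)+(\gamma_1+\cdots+\gamma_i)\,h_\nu(T_i)+\sum_{j=i+1}^k\gamma_j\,h_{\Pi_{i,j}\nu}(T_j)\Big\},$$ where $h$ is the Kolmogorov–Sinai entropy and $\Pi_{i,j}\nu$ is the image measure of $\nu$ under $\Pi_{i,j}$. Finally let $$I=\{2\le i\le k:\gamma_i>0\},\qquad \widetilde\theta_i=\frac{\gamma_1+\cdots+\gamma_{i-1}}{\gamma_1+\cdots+\gamma_i}.$$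 **Theorem 4.6.** Almost surely, if $K\neq\emptyset$ then $$\dim_H K\le\inf\{P_i(\theta):\ i\in I,\ \widetilde\theta_i\le\theta\le 1\},$$ with the convention $\inf\emptyset=+\infty$. -/

import Mathlib

open MeasureTheory ProbabilityTheory Filter

noncomputable section

/-! ## Entropy of a measure-preserving transformation -/

/-- Shannon entropy `-∑ ν(ξ = a) log ν(ξ = a)` of the finite partition `{ξ = a}`. -/
def shannonEntropy {X ι : Type*} [MeasurableSpace X] [Fintype ι] (ν : Measure X) (ξ : X → ι) : ℝ :=
  ∑ a, Real.negMulLog (ν.real (ξ ⁻¹' {a}))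

/-- The `n`-th joint partition `ξ ∨ T⁻¹ξ ∨ ⋯ ∨ T^{-(n-1)}ξ`. -/
def jointPartition {X ι : Type*} (T : X → X) (ξ : X → ι) (n : ℕ) : X → (Fin n → ι) :=
  fun x j => ξ (T^[j] x)

/-- Kolmogorov–Sinai entropy `h_ν(T)`: the supremum over finite measurable partitions `ξ` of
`lim (1/n) H_ν(ξ ∨ ⋯ ∨ T^{-(n-1)}ξ)` (for an invariant probability measure the limit exists). -/
def ksEntropy {X : Type*} [MeasurableSpace X] (T : X → X) (ν : Measure X) : EReal :=
  ⨆ (r : ℕ) (ξ : X → Fin r) (_ : Measurable ξ),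
    limsup (fun n : ℕ => ((shannonEntropy ν (jointPartition T ξ n) / n : ℝ) : EReal)) atTop

/-! ## Symbolic spaces -/

/-- The one-sided shift on sequences. -/
def shift {α : Type*} (x : ℕ → α) : ℕ → α := fun n => x (n + 1)

/-- `e^{-|x ∧ y| / c}`, where `|x ∧ y|` is the length of the longest common prefix
(infinite when `x = y`, in which case the value is `0`). -/
def prefixDist {α : Type*} (c : ℝ) (x y : ℕ → α) : ℝ :=
  open Classical in
  if x = y then 0 else Real.exp (-(PiNat.firstDiff (E := fun _ => α) x y : ℝ) / c)

theorem prefixDist_nonneg {α : Type*} (c : ℝ) (x y : ℕ → α) : 0 ≤ prefixDist c x y := by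
  unfold prefixDist; split_ifs <;> positivity

theorem prefixDist_self {α : Type*} (c : ℝ) (x : ℕ → α) : prefixDist c x x = 0 := by
  simp [prefixDist]

theorem prefixDist_comm {α : Type*} (c : ℝ) (x y : ℕ → α) :
    prefixDist c x y = prefixDist c y x := by
  by_cases h : x = y
  · rw [h]
  · simp only [prefixDist, if_neg h, if_neg (Ne.symm h),
      PiNat.firstDiff_comm (E := fun _ => α) x y]

theorem prefixDist_triangle {α : Type*} {c : ℝ} (hc : 0 < c) (x y z : ℕ → α) :
    prefixDist c x z ≤ max (prefixDist c x y) (prefixDist c y z) := by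
  by_cases hxz : x = z
  · subst hxz; simp [prefixDist_self, prefixDist_nonneg]
  by_cases hxy : x = y
  · subst hxy; simp
  by_cases hyz : y = z
  · subst hyz; simp
  have h := PiNat.min_firstDiff_le (E := fun _ => α) x y z hxz
  simp only [prefixDist, hxz, hxy, hyz, if_false]
  rcases min_le_iff.1 h with h | h
  · refine le_max_of_le_left ?_
    gcongr
  · refine le_max_of_le_right ?_
    gcongr

theorem eq_of_prefixDist_eq_zero {α : Type*} {c : ℝ} {x y : ℕ → α} (h : prefixDist c x y = 0) :
    x = y := by
  by_contra hne
  simp [prefixDist, hne, Real.exp_ne_zero] at h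

/-- The deterministic data: `k = m + 1` finite alphabets with at least two letters, surjective
one-block factor maps between consecutive ones, and the weights `γ_1 > 0`, `γ_2, …, γ_k ≥ 0`.
The level called `i ∈ {1, …, k}` in mathematical notation has index `i - 1 : Fin (m + 1)`. -/
structure SelfAffineSystem (m : ℕ) where
  alphabet : Fin (m + 1) → Type*
  finite_alphabet : ∀ i, Finite (alphabet i)
  two_le_card : ∀ i, 2 ≤ Nat.card (alphabet i)
  π : ∀ i : Fin m, alphabet i.castSucc → alphabet i.succ
  π_surjective : ∀ i, Function.Surjective (π i)
  γ : Fin (m + 1) → ℝ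
  γ_zero_pos : 0 < γ 0
  γ_nonneg : ∀ i, 0 ≤ γ i

namespace SelfAffineSystem

variable {m : ℕ} (S : SelfAffineSystem m)

instance (i : Fin (m + 1)) : Finite (S.alphabet i) := S.finite_alphabet i

/-- Alphabets are discrete; sequence spaces carry the product (= Borel) σ-algebra. -/
instance (i : Fin (m + 1)) : MeasurableSpace (S.alphabet i) := ⊤

/-- The map `Π_{i,j} = π_{j-1} ∘ ⋯ ∘ π_i` on letters, for `i ≤ j`. In particular
`S.proj (Fin.zero_le i)` is the projection of the first alphabet onto the one of index `i`. -/
def proj {i j : Fin (m + 1)} (h : i ≤ j) : S.alphabet i → S.alphabet j :=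
  Nat.leRec (motive := fun n _ => ∀ hn : n < m + 1, S.alphabet i → S.alphabet ⟨n, hn⟩)
    (fun _ a => a)
    (fun n _ f hn a => S.π ⟨n, Nat.lt_of_succ_lt_succ hn⟩ (f (Nat.lt_of_succ_lt hn) a))
    (show (i : ℕ) ≤ j from h) j.isLt

theorem proj_refl (i : Fin (m + 1)) (a : S.alphabet i) : S.proj (le_refl i) a = a := by
  unfold proj
  rw [Nat.leRec_self]

theorem proj_succ {i : Fin (m + 1)} {j : Fin m} (h : i ≤ j.castSucc) (a : S.alphabet i) :
    S.proj (h.trans (Fin.castSucc_le_succ j)) a = S.π j (S.proj h a) := by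
  have h' : (i : ℕ) ≤ (j : ℕ) := h
  unfold proj
  exact congrFun (congrFun (Nat.leRec_succ
    (motive := fun n _ => ∀ hn : n < m + 1, S.alphabet i → S.alphabet ⟨n, hn⟩)
    (fun _ a => a)
    (fun n _ f hn a => S.π ⟨n, Nat.lt_of_succ_lt_succ hn⟩ (f (Nat.lt_of_succ_lt hn) a))
    h') j.succ.isLt) a

/-- `γ_1 + ⋯ + γ_i`. -/
def γsum (i : Fin (m + 1)) : ℝ := ∑ j ∈ Finset.Iic i, S.γ j

theorem γsum_pos (i : Fin (m + 1)) : 0 < S.γsum i :=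
  Finset.sum_pos' (fun j _ => S.γ_nonneg j) ⟨0, by simp, S.γ_zero_pos⟩

/-- The space `X_1` of sequences over the first alphabet, with the ultrametric
`d(x, y) = max_i e^{-|Π_i x ∧ Π_i y| / (γ_1 + ⋯ + γ_i)}`. -/
def Point : Type _ := ℕ → S.alphabet 0

/-- The metric of the self-affine symbolic space. -/
def pointDist (x y : S.Point) : ℝ :=
  Finset.univ.sup' Finset.univ_nonempty fun i : Fin (m + 1) =>
    prefixDist (S.γsum i) (fun n => S.proj (Fin.zero_le i) (x n))
      (fun n => S.proj (Fin.zero_le i) (y n))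

theorem prefixDist_le_pointDist (i : Fin (m + 1)) (x y : S.Point) :
    prefixDist (S.γsum i) (fun n => S.proj (Fin.zero_le i) (x n))
      (fun n => S.proj (Fin.zero_le i) (y n)) ≤ S.pointDist x y :=
  Finset.le_sup' (fun i : Fin (m + 1) =>
    prefixDist (S.γsum i) (fun n => S.proj (Fin.zero_le i) (x n))
      (fun n => S.proj (Fin.zero_le i) (y n))) (Finset.mem_univ i)

theorem pointDist_nonneg (x y : S.Point) : 0 ≤ S.pointDist x y :=
  (prefixDist_nonneg _ _ _).trans (S.prefixDist_le_pointDist 0 x y)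

instance : MetricSpace S.Point where
  dist := S.pointDist
  dist_self x := by
    simp [pointDist, prefixDist_self]
  dist_comm x y := by
    unfold pointDist
    congr 1
    ext i
    exact prefixDist_comm _ _ _
  dist_triangle x y z := by
    refine Finset.sup'_le _ _ fun i _ => ?_
    refine (prefixDist_triangle (S.γsum_pos i) _ (fun n => S.proj (Fin.zero_le i) (y n)) _).trans ?_
    have h1 := S.prefixDist_le_pointDist i x y
    have h2 := S.prefixDist_le_pointDist i y z
    have h3 := S.pointDist_nonneg x y
    have h4 := S.pointDist_nonneg y z
    exact max_le (by linarith) (by linarith)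
  eq_of_dist_eq_zero {x y} h := by
    have h0 := S.prefixDist_le_pointDist 0 x y
    have h' : S.pointDist x y = 0 := h
    rw [h'] at h0
    have h1 := eq_of_prefixDist_eq_zero (le_antisymm h0 (prefixDist_nonneg _ _ _))
    funext n
    have h2 := congrFun h1 n
    simpa using (S.proj_refl 0 (x n)).symm.trans (h2.trans (S.proj_refl 0 (y n)))

/-! ## The random sponge -/

/-- The set `K_n` attached to a realisation `c` of the subsets `A(u)` (`c u a` tells whether
`a ∈ A(u)`): each of the first `n` letters of `x` belongs to `A` of the preceding prefix. -/
def spongeLevel (c : List (S.alphabet 0) → S.alphabet 0 → Bool) (n : ℕ) : Set S.Point :=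
  {x | ∀ i < n, c (List.ofFn fun j : Fin i => x j) (x i) = true}

/-- The sponge `K = ⋂_{n ≥ 1} K_n`. -/
def sponge (c : List (S.alphabet 0) → S.alphabet 0 → Bool) : Set S.Point :=
  ⋂ (n : ℕ) (_ : 1 ≤ n), S.spongeLevel c n

/-- `E(N_b^{(i)})`: the expected number of letters `a ∈ A` with `Π_i(a) = b`, where `law` is the
distribution of the random subset `A` of the first alphabet. -/
def meanCount (law : Measure (S.alphabet 0 → Bool)) (i : Fin (m + 1)) (b : S.alphabet i) : ℝ :=
  ∫ A, ({a | A a = true ∧ S.proj (Fin.zero_le i) a = b}.ncard : ℝ) ∂law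

/-- The reduced alphabet of letters `b` with `E(N_b^{(i)}) > 0`. -/
abbrev ReducedAlphabet (law : Measure (S.alphabet 0 → Bool)) (i : Fin (m + 1)) : Type _ :=
  {b : S.alphabet i // 0 < S.meanCount law i b}

/-! ## Weighted pressure -/

/-- `∑_{j ≥ i} β_j h_{Π_{i,j} ν}(T_j)` for a measure `ν` on sequences over the reduced alphabet
of index `i`. -/
def weightedEntropy (law : Measure (S.alphabet 0 → Bool)) (i : Fin (m + 1))
    (β : Fin (m + 1) → ℝ) (ν : Measure (ℕ → S.ReducedAlphabet law i)) : EReal :=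
  ∑ j : {j : Fin (m + 1) // i ≤ j},
    (β j : EReal) * ksEntropy (shift (α := S.alphabet j))
      (ν.map fun x n => S.proj j.2 (x n).1)

/-- The weighted pressure: the supremum of `ν(φ) + ∑_{j ≥ i} β_j h_{Π_{i,j} ν}(T_j)` over
shift-invariant probability measures `ν` on sequences over the reduced alphabet of index `i`. -/
def weightedPressure (law : Measure (S.alphabet 0 → Bool)) (i : Fin (m + 1))
    (β : Fin (m + 1) → ℝ) (φ : (ℕ → S.ReducedAlphabet law i) → ℝ) : EReal :=
  ⨆ (ν : Measure (ℕ → S.ReducedAlphabet law i)) (_ : IsProbabilityMeasure ν)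
    (_ : MeasurePreserving shift ν ν),
    ((∫ x, φ x ∂ν : ℝ) : EReal) + S.weightedEntropy law i β ν

/-- The vector `(γ_1 + ⋯ + γ_i, γ_{i+1}, …, γ_k)` (only coordinates of index `≥ i` are used). -/
def γvec (i : Fin (m + 1)) : Fin (m + 1) → ℝ := fun j => if j = i then S.γsum i else S.γ j

/-- The potential `φ_i(x) = (γ_1 + ⋯ + γ_i) log E(N_{x_1}^{(i)})`. -/
def potential (law : Measure (S.alphabet 0 → Bool)) (i : Fin (m + 1))
    (x : ℕ → S.ReducedAlphabet law i) : ℝ :=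
  S.γsum i * Real.log (S.meanCount law i (x 0).1)

/-- `P_i(θ)`, the weighted pressure of `θ φ_i` with weights `(γ_1 + ⋯ + γ_i, γ_{i+1}, …, γ_k)`. -/
def P (law : Measure (S.alphabet 0 → Bool)) (i : Fin (m + 1)) (θ : ℝ) : EReal :=
  S.weightedPressure law i (S.γvec i) fun x => θ * S.potential law i x

/-- The levels `2 ≤ i ≤ k` with `γ_i > 0`. -/
def activeLevels : Set (Fin (m + 1)) := {i | 0 < i ∧ 0 < S.γ i}

/-- `(γ_1 + ⋯ + γ_{i-1}) / (γ_1 + ⋯ + γ_i)`. -/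
def thetaTilde (i : Fin (m + 1)) : ℝ := (∑ j ∈ Finset.Iio i, S.γ j) / S.γsum i

end SelfAffineSystem

end

/-!
Fix a level `i` with `γ_i > 0` and `θ ∈ [θ̃_i, 1]`, and write `s_j = γ_1 + ⋯ + γ_j` and
`θ s_i = (1 - θ') s_{i-1} + θ' s_i` with `θ' ∈ [0, 1]`. Let `q a` be the probability that `a ∈ A`
and `M b = E(N_b^{(i)})`, the sum of `q` over the fibre of `b`.

*Lower bound for the pressure.* The supremum defining `P_i(θ)` is tested on one Bernoulli measure.
`exists_equilibrium` produces a probability weight `p` on the first alphabet, with conditional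
weights proportional to `q` on the fibres over level `i`, whose marginals `p_j` solve
`θ s_i log M - s_i log p_i - ∑_{j > i} γ_j log p_j = t` for a constant `t`. Integrating this
identity gives `t ≤ P_i(θ)` (`SelfAffineSystem.le_P_of_equilibrium`); only the easy inequality
between the Kolmogorov–Sinai entropy of a Bernoulli measure and the Shannon entropy of a letter is
needed.

*Upper bound for the dimension.* Cover `K` by cells of generation `n`: the letters are recorded
in the first alphabet up to position `s_{i-1} n`, then at level `i` up to position `s_i n`, at
level `i + 1` up to `s_{i+1} n`, and so on. Their diameter is `O(e^{-n})`. The probability that a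
cell is met by `K` is at most the mean number `U` of its words of length `s_{i-1} n`, and at most
the mean number `V` of its words of length `s_i n`, hence at most `U ^ (1 - θ') * V ^ θ'`. By the
identity above, the logarithm of the quotient of this bound by the Bernoulli mass of the cell is
`n t` plus `n` times a linear combination of differences of averages along the point, taken at
scales proportional to `n`. Such a combination has bounded integral with respect to `d log n`
(`logAverageNull_blockAvg_sub`), so along every sequence it is at most `ε` for infinitely many
`n` (`LogAverageNull.frequently_le`, `frequently_cell_weight_le`). Hence every point of `K` lies
in good cells of infinitely many generations, where a cell is good if its survival bound is at most
`e^{n (t + ε)}` times its mass. As masses add up to one, the expected number of good cells that are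
met is at most `e^{n (t + ε)}`, and the Hausdorff measure of dimension `t + 2 ε` of `K` is almost
surely finite.

Finally `P_i` is Lipschitz in `θ`, so a countable dense set of exponents suffices for an almost
sure statement about all of them.
-/

open MeasureTheory ProbabilityTheory Filter

noncomputable section

/-! ### Marginals and equilibrium weights -/

open scoped Classical in
/-- The image of the weight `p` under the map `e`. -/
def marg {A E : Type*} [Fintype A] (e : A → E) (p : A → ℝ) (b : E) : ℝ :=
  ∑ a with e a = b, p a

section marg

variable {A E : Type*} [Fintype A] (e : A → E)

theorem marg_nonneg {p : A → ℝ} (hp : ∀ a, 0 ≤ p a) (b : E) : 0 ≤ marg e p b :=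
  Finset.sum_nonneg fun a _ => hp a

theorem le_marg {p : A → ℝ} (hp : ∀ a, 0 ≤ p a) (a : A) : p a ≤ marg e p (e a) := by
  classical
  exact Finset.single_le_sum (f := p) (fun a _ => hp a) (by simp)

theorem marg_pos {p : A → ℝ} (hp : ∀ a, 0 ≤ p a) {a : A} (ha : 0 < p a) :
    0 < marg e p (e a) :=
  ha.trans_le (le_marg e hp a)

theorem sum_marg_mul [Fintype E] (p : A → ℝ) (f : E → ℝ) :
    ∑ b, marg e p b * f b = ∑ a, p a * f (e a) := by
  classical
  simp only [marg, Finset.sum_mul]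
  rw [← Finset.sum_fiberwise (s := Finset.univ) (g := e)]
  refine Finset.sum_congr rfl fun b _ => Finset.sum_congr rfl fun a ha => ?_
  rw [(Finset.mem_filter.1 ha).2]

theorem sum_marg [Fintype E] (p : A → ℝ) : ∑ b, marg e p b = ∑ a, p a := by
  simpa using sum_marg_mul e p fun _ => 1

theorem marg_mul_eq {p q : A → ℝ} {b : E} {r : ℝ} (h : ∀ a, e a = b → p a = q a * r) :
    marg e p b = marg e q b * r := by
  classical
  rw [marg, marg, Finset.sum_mul]
  exact Finset.sum_congr rfl fun a ha => h a (Finset.mem_filter.1 ha).2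

theorem marg_of_injective (he : Function.Injective e) (p : A → ℝ) (a : A) :
    marg e p (e a) = p a := by
  classical
  have : Finset.univ.filter (fun x => e x = e a) = {a} := by
    ext x; simp [he.eq_iff]
  rw [marg, this, Finset.sum_singleton]

theorem exists_of_marg_pos {p : A → ℝ} {b : E} (h : 0 < marg e p b) : ∃ a, e a = b ∧ 0 < p a := by
  classical
  obtain ⟨a, ha, h'⟩ := Finset.exists_lt_of_sum_lt
    (s := Finset.univ.filter fun a => e a = b) (f := fun _ => (0 : ℝ)) (g := p)
    (by simpa [marg] using h)
  exact ⟨a, (Finset.mem_filter.1 ha).2, h'⟩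

end marg

/-- Existence of the equilibrium state: for a chain of factors `e j` of a finite alphabet, and a
potential `w` that depends on the factor of index `j`, there is a probability weight `p` whose
conditional weights on the fibres of `e j` are those of `q`, and whose marginals solve the
Euler–Lagrange equation of the weighted pressure with weights `s, γ (j + 1), …, γ m`. The proof
solves the coarser levels first, with `s * log` of a fibre sum of `exp (w / s)` as potential. -/
theorem exists_equilibrium {A : Type*} [Fintype A] {m : ℕ} {E : Fin (m + 1) → Type*}
    (e : ∀ j, A → E j)
    (href : ∀ (j : Fin m) a a', e j.castSucc a = e j.castSucc a' → e j.succ a = e j.succ a')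
    (γ : Fin (m + 1) → ℝ) (hγ : ∀ j, 0 ≤ γ j) (j : Fin (m + 1)) :
    ∀ (q : A → ℝ), (∀ a, 0 ≤ q a) → (∃ a, 0 < q a) → ∀ (w : E j → ℝ) (s : ℝ), 0 < s →
      ∃ (p : A → ℝ) (t : ℝ), (∀ a, 0 < q a → 0 < p a) ∧ (∀ a, q a = 0 → p a = 0) ∧
        ∑ a, p a = 1 ∧
        (∀ a, p a * marg (e j) q (e j a) = q a * marg (e j) p (e j a)) ∧
        ∀ a, 0 < q a → w (e j a) - s * Real.log (marg (e j) p (e j a)) -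
          ∑ l ∈ Finset.Ioi j, γ l * Real.log (marg (e l) p (e l a)) = t := by
  induction j using Fin.reverseInduction with
  | last =>
    intro q hq ⟨a₀, ha₀⟩ w s hs
    set h : E (Fin.last m) → ℝ := fun b =>
      Real.exp (w b / s) / marg (e (Fin.last m)) q b with hh
    set Z : ℝ := ∑ a, q a * h (e _ a) with hZ
    have hpos : ∀ a, 0 < q a → 0 < q a * h (e _ a) := fun a ha =>
      mul_pos ha (div_pos (Real.exp_pos _) (marg_pos _ hq ha))
    have hZpos : 0 < Z := by
      refine Finset.sum_pos' (fun a _ => ?_) ⟨a₀, Finset.mem_univ _, hpos a₀ ha₀⟩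
      rcases (hq a).eq_or_lt with h0 | h0
      · simp [← h0]
      · exact (hpos a h0).le
    have hm : ∀ b, marg (e (Fin.last m)) (fun a => q a * h (e _ a) / Z) b =
        marg (e (Fin.last m)) q b * (h b / Z) := fun b => by
      apply marg_mul_eq
      rintro a rfl
      ring
    refine ⟨fun a => q a * h (e _ a) / Z, s * Real.log Z, fun a ha => div_pos (hpos a ha) hZpos,
      fun a ha => by simp [ha], ?_, fun a => ?_, fun a ha => ?_⟩
    · rw [← Finset.sum_div, div_self hZpos.ne']
    · rw [hm]; ring
    · have hq' := marg_pos (e (Fin.last m)) hq ha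
      rw [hm, hh]
      have : marg (e (Fin.last m)) q (e _ a) *
          (Real.exp (w (e _ a) / s) / marg (e (Fin.last m)) q (e _ a) / Z) =
          Real.exp (w (e _ a) / s) / Z := by
        field_simp
      simp only [this]
      rw [Real.log_div (Real.exp_ne_zero _) hZpos.ne', Real.log_exp]
      have hI : Finset.Ioi (Fin.last m) = ∅ := by
        ext x; simpa using Fin.le_last x
      rw [hI]
      simp only [Finset.sum_empty]
      field_simp
      ring
  | cast j ih =>
    intro q hq ⟨a₀, ha₀⟩ w s hs
    set e₀ := e j.castSucc with he₀
    set e₁ := e j.succ with he₁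
    set h : E j.castSucc → ℝ := fun b => Real.exp (w b / s) / marg e₀ q b with hh
    set q₁ : A → ℝ := fun a => q a * h (e₀ a) with hq₁
    have hpos : ∀ a, 0 < q a → 0 < q₁ a := fun a ha =>
      mul_pos ha (div_pos (Real.exp_pos _) (marg_pos _ hq ha))
    have hq₁n : ∀ a, 0 ≤ q₁ a := fun a => by
      rcases (hq a).eq_or_lt with h0 | h0
      · simp [hq₁, ← h0]
      · exact (hpos a h0).le
    obtain ⟨p, t, hp1, hp2, hp3, hp4, hp5⟩ := ih q₁ hq₁n ⟨a₀, hpos a₀ ha₀⟩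
      (fun c => s * Real.log (marg e₁ q₁ c)) (s + γ j.succ) (by have := hγ j.succ; linarith)
    have hpq : ∀ a, q a = 0 → p a = 0 := fun a ha => hp2 a (by simp [hq₁, ha])
    have hpn : ∀ a, 0 ≤ p a := fun a => by
      rcases (hq a).eq_or_lt with h0 | h0
      · exact (hpq a h0.symm).ge
      · exact (hp1 a (hpos a h0)).le
    have hpa : ∀ a, 0 < q a → p a = q a * (h (e₀ a) * (marg e₁ p (e₁ a) / marg e₁ q₁ (e₁ a))) := by
      intro a ha
      have h1 := marg_pos e₁ hq₁n (hpos a ha)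
      have h2 := hp4 a
      rw [← mul_assoc, ← mul_div_assoc, eq_div_iff h1.ne', h2]
    have hmp : ∀ a, 0 < q a → marg e₀ p (e₀ a) =
        Real.exp (w (e₀ a) / s) * (marg e₁ p (e₁ a) / marg e₁ q₁ (e₁ a)) := by
      intro a ha
      rw [marg_mul_eq e₀ (q := q)
        (r := h (e₀ a) * (marg e₁ p (e₁ a) / marg e₁ q₁ (e₁ a)))]
      · have := marg_pos e₀ hq ha
        rw [hh]
        field_simp
      · intro a' haa
        rcases (hq a').eq_or_lt with h0 | h0
        · rw [hpq a' h0.symm, ← h0, zero_mul]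
        · rw [hpa a' h0, haa, show e₁ a' = e₁ a from href j a' a haa]
    refine ⟨p, t, fun a ha => hp1 a (hpos a ha), hpq, hp3, fun a => ?_, fun a ha => ?_⟩
    · rcases (hq a).eq_or_lt with h0 | h0
      · rw [hpq a h0.symm, ← h0, zero_mul, zero_mul]
      · rw [hmp a h0, hpa a h0, hh]
        have := marg_pos e₀ hq h0
        field_simp
    · have h1 := marg_pos e₁ hq₁n (hpos a ha)
      have h2 := marg_pos e₁ hpn (hp1 a (hpos a ha))
      rw [← hp5 a (hpos a ha), hmp a ha,
        Real.log_mul (Real.exp_ne_zero _) (div_pos h2 h1).ne', Real.log_exp,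
        Real.log_div h2.ne' h1.ne']
      have hI : Finset.Ioi j.castSucc = insert j.succ (Finset.Ioi j.succ) := by
        ext x
        simp only [Finset.mem_Ioi, Finset.mem_insert, Fin.lt_def, Fin.ext_iff, Fin.val_castSucc,
          Fin.val_succ]
        omega
      rw [hI, Finset.sum_insert (by simp), ← he₁]
      field_simp
      ring

/-! ### Block averages at different scales -/

/-- The average `R⁻¹ ∑_{k < ⌊R⌋} a k`. -/
def blockAvg (a : ℕ → ℝ) (R : ℝ) : ℝ := (∑ k ∈ Finset.range ⌊R⌋₊, a k) / R

/-- A function whose average with respect to `dR / R` over `[1, T]` tends to zero at the speed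
`1 / log T`, and which is asymptotically determined by its values at integers. -/
structure LogAverageNull (D : ℝ → ℝ) : Prop where
  integrable : ∀ T, 0 ≤ T → IntervalIntegrable (fun τ => D (Real.exp τ)) volume 0 T
  bounded : ∃ C, ∀ T, 0 ≤ T → |∫ τ in (0 : ℝ)..T, D (Real.exp τ)| ≤ C
  slow : Tendsto (fun R => D R - D ⌊R⌋₊) atTop (nhds 0)

namespace LogAverageNull

theorem zero : LogAverageNull fun _ => 0 where
  integrable T _ := intervalIntegrable_const
  bounded := ⟨0, fun T _ => by simp⟩
  slow := by simp

theorem add {D₁ D₂ : ℝ → ℝ} (h₁ : LogAverageNull D₁) (h₂ : LogAverageNull D₂) :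
    LogAverageNull fun R => D₁ R + D₂ R where
  integrable T hT := (h₁.integrable T hT).add (h₂.integrable T hT)
  bounded := by
    obtain ⟨C₁, hC₁⟩ := h₁.bounded
    obtain ⟨C₂, hC₂⟩ := h₂.bounded
    refine ⟨C₁ + C₂, fun T hT => ?_⟩
    rw [intervalIntegral.integral_add (h₁.integrable T hT) (h₂.integrable T hT)]
    exact (abs_add_le _ _).trans (add_le_add (hC₁ T hT) (hC₂ T hT))
  slow := by
    have := h₁.slow.add h₂.slow
    rw [add_zero] at this
    exact this.congr fun R => by ring

theorem const_mul {D : ℝ → ℝ} (h : LogAverageNull D) (w : ℝ) :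
    LogAverageNull fun R => w * D R where
  integrable T hT := (h.integrable T hT).const_mul w
  bounded := by
    obtain ⟨C, hC⟩ := h.bounded
    refine ⟨|w| * C, fun T hT => ?_⟩
    rw [intervalIntegral.integral_const_mul, abs_mul]
    exact mul_le_mul_of_nonneg_left (hC T hT) (abs_nonneg _)
  slow := by
    have := h.slow.const_mul w
    rw [mul_zero] at this
    exact this.congr fun R => by ring

theorem sum {ι : Type*} (s : Finset ι) {D : ι → ℝ → ℝ} (h : ∀ i ∈ s, LogAverageNull (D i)) :
    LogAverageNull fun R => ∑ i ∈ s, D i R := by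
  classical
  induction s using Finset.induction_on with
  | empty => simpa using zero
  | insert i s his ih =>
    simp only [Finset.sum_insert his]
    exact (h i (by simp)).add (ih fun j hj => h j (by simp [hj]))

/-- Such a function cannot stay above `ε` at all large integers: its integral in `log R` would
diverge. -/
theorem frequently_le {D : ℝ → ℝ} (h : LogAverageNull D) {ε : ℝ} (hε : 0 < ε) :
    ∃ᶠ n : ℕ in atTop, D n ≤ ε := by
  by_contra hcon
  rw [not_frequently] at hcon
  have h1 : ∀ᶠ R : ℝ in atTop, ε / 2 ≤ D R := by
    have h2 := (tendsto_nat_floor_atTop (α := ℝ)).eventually hcon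
    have h3 := h.slow.eventually (lt_mem_nhds (show -(ε / 2) < 0 by linarith))
    filter_upwards [h2, h3] with R h2 h3
    linarith
  have h4 := Real.tendsto_exp_atTop.eventually h1
  obtain ⟨T₀, hT₀⟩ := eventually_atTop.1 h4
  obtain ⟨C, hC⟩ := h.bounded
  set T₁ := max T₀ 0 with hT₁
  have h01 : 0 ≤ T₁ := le_max_right _ _
  have key : ∀ T, T₁ ≤ T → (T - T₁) * (ε / 2) ≤ 2 * C := by
    intro T hT
    have hi1 := h.integrable T₁ h01
    have hi2 := h.integrable T (h01.trans hT)
    have hi3 := hi1.symm.trans hi2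
    have e1 := intervalIntegral.integral_interval_sub_left hi2 hi1
    have e2 : ∫ _ in T₁..T, ε / 2 ≤ ∫ τ in T₁..T, D (Real.exp τ) := by
      refine intervalIntegral.integral_mono_on hT intervalIntegrable_const hi3 fun τ hτ => ?_
      exact hT₀ τ ((le_max_left _ _).trans hτ.1)
    rw [intervalIntegral.integral_const, smul_eq_mul, ← e1] at e2
    have e3 := abs_le.1 (hC T (h01.trans hT))
    have e4 := abs_le.1 (hC T₁ h01)
    linarith [e3.2, e4.1]
  have hC0 : 0 ≤ C := (abs_nonneg _).trans (hC 0 le_rfl)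
  have := key (T₁ + (2 * C + 1) / (ε / 2)) (by
    have : 0 ≤ (2 * C + 1) / (ε / 2) := by positivity
    linarith)
  rw [add_sub_cancel_left, div_mul_cancel₀ _ (by positivity)] at this
  linarith

end LogAverageNull

section blockAvg

variable {a : ℕ → ℝ} {C : ℝ}

theorem abs_sum_range_le (ha : ∀ k, |a k| ≤ C) (N : ℕ) : |∑ k ∈ Finset.range N, a k| ≤ N * C := by
  refine (Finset.abs_sum_le_sum_abs _ _).trans ((Finset.sum_le_sum fun k _ => ha k).trans ?_)
  simp

theorem abs_blockAvg_le (ha : ∀ k, |a k| ≤ C) {R : ℝ} (hR : 0 < R) : |blockAvg a R| ≤ C := by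
  have hC : 0 ≤ C := (abs_nonneg _).trans (ha 0)
  rw [blockAvg, abs_div, abs_of_pos hR, div_le_iff₀ hR, mul_comm]
  exact (abs_sum_range_le ha _).trans
    (mul_le_mul_of_nonneg_right (Nat.floor_le hR.le) hC)

theorem measurable_blockAvg (a : ℕ → ℝ) : Measurable (blockAvg a) := by
  unfold blockAvg
  have : Measurable fun N : ℕ => ∑ k ∈ Finset.range N, a k := measurable_from_nat
  exact (this.comp Nat.measurable_floor).div measurable_id

/-- Replacing `R` by its integer part changes a block average at scale `β R` by `O(1 / R)`. -/
theorem tendsto_blockAvg_sub_floor (ha : ∀ k, |a k| ≤ C) {β : ℝ} (hβ : 0 < β) :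
    Tendsto (fun R => blockAvg a (β * R) - blockAvg a (β * ⌊R⌋₊)) atTop (nhds 0) := by
  have hC : 0 ≤ C := (abs_nonneg _).trans (ha 0)
  refine squeeze_zero_norm' (a := fun R => ((β + 1) * C + β * C) / β * R⁻¹) ?_
    (by simpa using tendsto_inv_atTop_zero.const_mul (((β + 1) * C + β * C) / β))
  filter_upwards [eventually_ge_atTop (1 : ℝ)] with R hR
  have hR0 : 0 < R := by linarith
  have hn1 : (1 : ℝ) ≤ (⌊R⌋₊ : ℝ) := by exact_mod_cast Nat.le_floor (by simpa using hR)
  have hn2 : (⌊R⌋₊ : ℝ) ≤ R := Nat.floor_le hR0.le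
  have hn3 : R < ⌊R⌋₊ + 1 := Nat.lt_floor_add_one R
  set n : ℝ := (⌊R⌋₊ : ℝ)
  have hn0 : 0 < n := by linarith
  set S : ℝ → ℝ := fun x => ∑ k ∈ Finset.range ⌊x⌋₊, a k with hS
  have h1 : |S (β * R) - S (β * n)| ≤ (β + 1) * C := by
    have hle : ⌊β * n⌋₊ ≤ ⌊β * R⌋₊ := Nat.floor_le_floor (by gcongr)
    have : S (β * R) - S (β * n) = ∑ k ∈ Finset.Ico ⌊β * n⌋₊ ⌊β * R⌋₊, a k := by
      rw [Finset.sum_Ico_eq_sub _ hle]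
    rw [this]
    refine (Finset.abs_sum_le_sum_abs _ _).trans ((Finset.sum_le_sum fun k _ => ha k).trans ?_)
    rw [Finset.sum_const, Nat.card_Ico, nsmul_eq_mul]
    refine mul_le_mul_of_nonneg_right ?_ hC
    rw [Nat.cast_sub hle]
    have e1 : (⌊β * R⌋₊ : ℝ) ≤ β * R := Nat.floor_le (by positivity)
    have e2 : β * n < ⌊β * n⌋₊ + 1 := Nat.lt_floor_add_one _
    nlinarith
  have h2 : |S (β * n)| ≤ β * n * C :=
    (abs_sum_range_le ha _).trans (mul_le_mul_of_nonneg_right (Nat.floor_le (by positivity)) hC)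
  have h3 : blockAvg a (β * R) - blockAvg a (β * n) =
      ((S (β * R) - S (β * n)) - S (β * n) / n * (R - n)) / β * R⁻¹ := by
    simp only [blockAvg]
    change S (β * R) / (β * R) - S (β * n) / (β * n) = _
    field_simp
    ring
  rw [Real.norm_eq_abs, h3, abs_mul, abs_div, abs_of_pos hβ, abs_of_pos (inv_pos.2 hR0)]
  gcongr
  refine (abs_sub _ _).trans (add_le_add h1 ?_)
  rw [abs_mul, abs_div, abs_of_pos hn0]
  have h4 : |S (β * n)| / n ≤ β * C := by
    rw [div_le_iff₀ hn0]; linarith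
  have h5 : |R - n| ≤ 1 := by rw [abs_le]; constructor <;> linarith
  calc |S (β * n)| / n * |R - n| ≤ β * C * 1 := by gcongr
    _ = β * C := mul_one _

/-- In the variable `τ = log R`, the difference of the block averages at the scales `β R` and
`α R` is the difference of two translates of one bounded function, so its integrals are bounded. -/
theorem logAverageNull_blockAvg_sub (ha : ∀ k, |a k| ≤ C) {α β : ℝ} (hα : 0 < α) (hβ : 0 < β) :
    LogAverageNull fun R => blockAvg a (β * R) - blockAvg a (α * R) := by
  set g : ℝ → ℝ := fun τ => blockAvg a (Real.exp τ) with hg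
  have hgm : Measurable g := (measurable_blockAvg a).comp Real.measurable_exp
  have hgb : ∀ τ, |g τ| ≤ C := fun τ => abs_blockAvg_le ha (Real.exp_pos τ)
  have hgi : ∀ x y, IntervalIntegrable g volume x y := fun x y => by
    refine intervalIntegrable_const (c := C) |>.mono_fun hgm.aestronglyMeasurable ?_
    refine Eventually.of_forall fun τ => ?_
    change |g τ| ≤ |C|
    exact (hgb τ).trans (le_abs_self C)
  have hshift : ∀ β : ℝ, 0 < β → ∀ τ, blockAvg a (β * Real.exp τ) = g (τ + Real.log β) := by
    intro β hβ τ
    rw [hg]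
    simp only
    rw [Real.exp_add, Real.exp_log hβ, mul_comm]
  have hsi : ∀ b x y : ℝ, IntervalIntegrable (fun τ => g (τ + b)) volume x y := fun b x y => by
    have := (hgi (x + b) (y + b)).comp_add_right b
    simpa using this
  refine ⟨fun T hT => ?_, ⟨2 * (C * |Real.log β - Real.log α|), fun T hT => ?_⟩, ?_⟩
  · simp only [hshift β hβ, hshift α hα]
    exact (hsi _ 0 T).sub (hsi _ 0 T)
  · simp only [hshift β hβ, hshift α hα]
    rw [intervalIntegral.integral_sub (hsi _ 0 T) (hsi _ 0 T),
      intervalIntegral.integral_comp_add_right, intervalIntegral.integral_comp_add_right,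
      intervalIntegral.integral_interval_sub_interval_comm' (hgi _ _) (hgi _ _) (hgi _ _)]
    have hb : ∀ x y, |∫ τ in x..y, g τ| ≤ C * |y - x| := fun x y =>
      intervalIntegral.norm_integral_le_of_norm_le_const (f := g) fun τ _ => hgb τ
    have h1 := hb (T + Real.log α) (T + Real.log β)
    have h2 := hb (0 + Real.log α) (0 + Real.log β)
    have h3 : T + Real.log β - (T + Real.log α) = Real.log β - Real.log α := by ring
    have h4 : 0 + Real.log β - (0 + Real.log α) = Real.log β - Real.log α := by ring
    rw [h3] at h1
    rw [h4] at h2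
    refine (abs_sub _ _).trans ?_
    linarith
  · have := (tendsto_blockAvg_sub_floor ha hβ).sub (tendsto_blockAvg_sub_floor ha hα)
    rw [sub_zero] at this
    exact this.congr fun R => by ring

end blockAvg

/-! ### Bernoulli measures and their entropy -/

theorem sum_negMulLog_prod {ι : Type*} [Fintype ι] {p : ι → ℝ} (hp : ∑ a, p a = 1) (n : ℕ) :
    ∑ a : Fin n → ι, Real.negMulLog (∏ j, p (a j)) = n * ∑ a, Real.negMulLog (p a) := by
  induction n with
  | zero => simp
  | succ n ih =>
    have h1 : ∑ a : Fin n → ι, ∏ j, p (a j) = 1 := by rw [← Fintype.sum_pow, hp, one_pow]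
    rw [← (Fin.consEquiv fun _ : Fin (n + 1) => ι).sum_comp, Fintype.sum_prod_type]
    simp only [Fin.consEquiv, Equiv.coe_fn_mk, Fin.prod_univ_succ, Fin.cons_zero, Fin.cons_succ,
      Real.negMulLog_mul, Finset.sum_add_distrib, ← Finset.mul_sum, ← Finset.sum_mul, ih, h1, hp]
    push_cast
    ring

theorem shift_iterate_apply {α : Type*} (n : ℕ) (x : ℕ → α) (k : ℕ) :
    (shift^[n] x) k = x (k + n) := by
  induction n generalizing k with
  | zero => rfl
  | succ n ih =>
    rw [Function.iterate_succ_apply']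
    change (shift^[n] x) (k + 1) = _
    rw [ih]
    congr 1
    ring

theorem measurable_shift {B : Type*} [MeasurableSpace B] : Measurable (shift (α := B)) :=
  measurable_pi_lambda _ fun n => measurable_pi_apply (n + 1)

theorem measurePreserving_shift_infinitePi {B : Type*} [MeasurableSpace B] (ρ : Measure B)
    [IsProbabilityMeasure ρ] :
    MeasurePreserving shift (Measure.infinitePi fun _ : ℕ => ρ)
      (Measure.infinitePi fun _ : ℕ => ρ) := by
  refine ⟨measurable_shift, Measure.eq_infinitePi _ fun s t ht => ?_⟩
  rw [Measure.map_apply measurable_shift (MeasurableSet.pi s.countable_toSet fun i _ => ht i)]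
  have : shift ⁻¹' (Set.pi (s : Set ℕ) t) =
      Set.pi ((s.map (addRightEmbedding 1) : Finset ℕ) : Set ℕ) fun i => t (i - 1) := by
    ext x
    simp [shift, Set.mem_pi]
  rw [this, Measure.infinitePi_pi _ fun i _ => ht _]
  simp

/-- The entropy of a letterwise image of a Bernoulli measure is at least the Shannon entropy of
the law of one letter: use the partition according to the first letter. -/
theorem le_ksEntropy_map_infinitePi {A B : Type*} [MeasurableSpace A] [Fintype A]
    [DiscreteMeasurableSpace A] [MeasurableSpace B] (ρ : Measure B)
    [IsProbabilityMeasure ρ] {f : B → A} (hf : Measurable f) :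
    ((∑ a, Real.negMulLog (ρ.real (f ⁻¹' {a})) : ℝ) : EReal) ≤
      ksEntropy shift ((Measure.infinitePi fun _ : ℕ => ρ).map fun x n => f (x n)) := by
  set e := Fintype.equivFin A
  set ξ : (ℕ → A) → Fin (Fintype.card A) := fun x => e (x 0) with hξ
  have hξm : Measurable ξ := (Measurable.of_discrete (f := e)).comp (measurable_pi_apply 0)
  have hF : Measurable fun (x : ℕ → B) n => f (x n) :=
    measurable_pi_lambda _ fun n => hf.comp (measurable_pi_apply n)
  set P : Fin (Fintype.card A) → ℝ := fun k => ρ.real (f ⁻¹' {e.symm k}) with hP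
  have hsum : ∑ k, P k = 1 := by
    rw [hP, e.symm.sum_comp fun a => ρ.real (f ⁻¹' {a})]
    have := sum_measureReal_preimage_singleton (μ := ρ) (f := f) Finset.univ
      fun y _ => hf (measurableSet_singleton y)
    rw [this]
    simp
  refine le_trans ?_ (le_iSup_of_le (Fintype.card A) (le_iSup_of_le ξ (le_iSup_of_le hξm le_rfl)))
  refine le_limsup_of_frequently_le (Eventually.frequently ?_)
  filter_upwards [eventually_ge_atTop 1] with n hn
  rw [EReal.coe_le_coe_iff]
  refine le_of_eq ?_
  have hn0 : (n : ℝ) ≠ 0 := by positivity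
  rw [eq_div_iff hn0]
  have hcyl : ∀ a : Fin n → Fin (Fintype.card A),
      ((Measure.infinitePi fun _ : ℕ => ρ).map fun x n => f (x n)).real
        (jointPartition shift ξ n ⁻¹' {a}) = ∏ j, P (a j) := by
    intro a
    have hjm : Measurable (jointPartition shift ξ n) :=
      measurable_pi_lambda _ fun j => hξm.comp (measurable_shift.iterate j)
    rw [map_measureReal_apply hF (hjm (measurableSet_singleton a))]
    have : (fun (x : ℕ → B) n => f (x n)) ⁻¹' (jointPartition shift ξ n ⁻¹' {a}) =
        Set.pi ((Finset.range n : Finset ℕ) : Set ℕ) fun k =>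
          if h : k < n then f ⁻¹' {e.symm (a ⟨k, h⟩)} else Set.univ := by
      ext x
      simp only [Set.mem_preimage, Set.mem_singleton_iff, Set.mem_pi, Finset.coe_range,
        Set.mem_Iio, funext_iff, jointPartition, hξ, shift_iterate_apply, zero_add]
      constructor
      · intro h k hk
        simp only [hk, dif_pos, Set.mem_preimage, Set.mem_singleton_iff]
        rw [Equiv.eq_symm_apply]
        exact h ⟨k, hk⟩
      · intro h k
        have := h k k.2
        simp only [k.2, dif_pos, Set.mem_preimage, Set.mem_singleton_iff] at this
        rw [Equiv.eq_symm_apply] at this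
        exact this
    rw [this, measureReal_def, Measure.infinitePi_pi, Finset.prod_range, ENNReal.toReal_prod]
    · refine Finset.prod_congr rfl fun j _ => ?_
      simp [hP, measureReal_def]
    · intro k _
      split_ifs
      · exact hf (measurableSet_singleton _)
      · exact MeasurableSet.univ
  rw [shannonEntropy]
  simp only [hcyl]
  rw [sum_negMulLog_prod hsum, mul_comm, hP,
    e.symm.sum_comp fun a => Real.negMulLog (ρ.real (f ⁻¹' {a}))]

theorem integral_comp_zero_infinitePi {B : Type*} [MeasurableSpace B] (ρ : Measure B)
    [IsProbabilityMeasure ρ] {F : B → ℝ} (hF : AEStronglyMeasurable F ρ) :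
    ∫ x, F (x 0) ∂(Measure.infinitePi fun _ : ℕ => ρ) = ∫ b, F b ∂ρ := by
  have h := measurePreserving_eval_infinitePi (fun _ : ℕ => ρ) 0
  have h' := integral_map (f := F) h.measurable.aemeasurable (by rwa [h.map_eq])
  rw [h.map_eq] at h'
  exact h'.symm

theorem exists_measure_of_weight {A : Type*} [Fintype A] [MeasurableSpace A]
    [MeasurableSingletonClass A] {p : A → ℝ} (hp : ∀ a, 0 ≤ p a) (hp1 : ∑ a, p a = 1) :
    ∃ τ : Measure A, IsProbabilityMeasure τ ∧ ∀ a, τ.real {a} = p a := by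
  have h1 : ∑ a, ENNReal.ofReal (p a) = 1 := by
    rw [← ENNReal.ofReal_sum_of_nonneg fun a _ => hp a, hp1, ENNReal.ofReal_one]
  refine ⟨(PMF.ofFintype _ h1).toMeasure, inferInstance, fun a => ?_⟩
  rw [measureReal_def, PMF.toMeasure_apply_singleton _ _ (measurableSet_singleton a)]
  simp [ENNReal.toReal_ofReal (hp a)]

theorem ereal_coe_sum {ι : Type*} (s : Finset ι) (f : ι → ℝ) :
    ((∑ i ∈ s, f i : ℝ) : EReal) = ∑ i ∈ s, (f i : EReal) := by
  classical
  induction s using Finset.induction_on with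
  | empty => simp
  | insert i s hi ih => rw [Finset.sum_insert hi, Finset.sum_insert hi, EReal.coe_add, ih]

namespace SelfAffineSystem

variable {m : ℕ} (S : SelfAffineSystem m)

instance (i : Fin (m + 1)) : Fintype (S.alphabet i) := Fintype.ofFinite _

instance (i : Fin (m + 1)) : DiscreteMeasurableSpace (S.alphabet i) := ⟨fun _ => trivial⟩

/-! ### Projections of letters, mean counts and the pressure -/

/-- The projection `Π_j` from the first alphabet. -/
def letter (j : Fin (m + 1)) : S.alphabet 0 → S.alphabet j := S.proj (Fin.zero_le j)

theorem letter_zero (a : S.alphabet 0) : S.letter 0 a = a := S.proj_refl 0 a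

theorem letter_succ (j : Fin m) (a : S.alphabet 0) :
    S.letter j.succ a = S.π j (S.letter j.castSucc a) :=
  S.proj_succ (Fin.zero_le _) a

theorem proj_letter {i j : Fin (m + 1)} (h : i ≤ j) (a : S.alphabet 0) :
    S.proj h (S.letter i a) = S.letter j a := by
  induction j using Fin.induction with
  | zero =>
    obtain rfl : i = 0 := le_antisymm h (Fin.zero_le i)
    exact S.proj_refl _ _
  | succ j ih =>
    rcases h.eq_or_lt with rfl | h'
    · exact S.proj_refl _ _
    · have h'' : i ≤ j.castSucc := Fin.le_castSucc_iff.2 h'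
      rw [letter_succ, ← ih h'']
      exact S.proj_succ h'' _

/-- The probability that the letter `a` belongs to the random set `A`. -/
def occProb (law : Measure (S.alphabet 0 → Bool)) (a : S.alphabet 0) : ℝ :=
  law.real {A | A a = true}

section

variable (law : Measure (S.alphabet 0 → Bool))

theorem occProb_nonneg (a : S.alphabet 0) : 0 ≤ S.occProb law a := measureReal_nonneg

theorem integral_ncard [IsProbabilityMeasure law] (p : S.alphabet 0 → Prop) [DecidablePred p] :
    ∫ A, ({a | A a = true ∧ p a}.ncard : ℝ) ∂law = ∑ a with p a, S.occProb law a := by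
  have h1 : ∀ A : S.alphabet 0 → Bool, ({a | A a = true ∧ p a}.ncard : ℝ) =
      ∑ a with p a, {A : S.alphabet 0 → Bool | A a = true}.indicator (fun _ => (1 : ℝ)) A := by
    intro A
    have : {a | A a = true ∧ p a} =
        (((Finset.univ.filter p).filter fun a => A a = true : Finset (S.alphabet 0)) :
          Set (S.alphabet 0)) := by
      ext a; simp [and_comm]
    rw [this, Set.ncard_coe_finset, Finset.card_filter]
    push_cast
    refine Finset.sum_congr rfl fun a _ => ?_
    simp [Set.indicator_apply]
  simp only [h1]
  have hm : ∀ a, MeasurableSet {A : S.alphabet 0 → Bool | A a = true} := fun a =>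
    (measurableSet_singleton true).preimage (measurable_pi_apply a)
  rw [integral_finsetSum _ fun a _ => (integrable_const (1 : ℝ)).indicator (hm a)]
  refine Finset.sum_congr rfl fun a _ => ?_
  rw [integral_indicator_const _ (hm a), smul_eq_mul, mul_one]
  rfl

theorem meanCount_eq [IsProbabilityMeasure law] (i : Fin (m + 1)) (b : S.alphabet i) :
    S.meanCount law i b = marg (S.letter i) (S.occProb law) b := by
  classical
  exact S.integral_ncard law _

/-- A weight on the first alphabet that satisfies the Euler–Lagrange equation of the weighted
pressure with constant `t` gives a Bernoulli measure witnessing `t ≤ P_i(θ)`. -/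
theorem le_P_of_equilibrium [IsProbabilityMeasure law] (i : Fin (m + 1)) (θ t : ℝ)
    {p : S.alphabet 0 → ℝ} (hp : ∀ a, 0 ≤ p a) (hp1 : ∑ a, p a = 1)
    (hpq : ∀ a, 0 < p a → 0 < S.occProb law a)
    (ht : ∀ a, 0 < p a → θ * (S.γsum i * Real.log (S.meanCount law i (S.letter i a))) -
      ∑ j : {j : Fin (m + 1) // i ≤ j}, S.γvec i j *
        Real.log (marg (S.letter j) p (S.letter j a)) = t) :
    (t : EReal) ≤ S.P law i θ := by
  classical
  have hred : ∀ a, 0 < p a → 0 < S.meanCount law i (S.letter i a) := fun a ha => by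
    rw [meanCount_eq]
    exact marg_pos _ (S.occProb_nonneg law) (hpq a ha)
  obtain ⟨a₀, ha₀⟩ : ∃ a, 0 < p a := by
    by_contra! h
    have := Finset.sum_nonpos fun a (_ : a ∈ Finset.univ) => h a
    linarith
  -- letters of weight zero are sent to an arbitrary letter of the reduced alphabet
  set h : S.alphabet 0 → S.ReducedAlphabet law i := fun a =>
    if ha : 0 < p a then ⟨S.letter i a, hred a ha⟩ else ⟨S.letter i a₀, hred a₀ ha₀⟩ with hh
  obtain ⟨τ, hτ, hτp⟩ := exists_measure_of_weight hp hp1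
  have hhm : Measurable h := Measurable.of_discrete
  have hρ : IsProbabilityMeasure (τ.map h) := Measure.isProbabilityMeasure_map hhm.aemeasurable
  set ρ := τ.map h with hρdef
  set ν := Measure.infinitePi fun _ : ℕ => ρ with hν
  have hmarg : ∀ (j : {j : Fin (m + 1) // i ≤ j}) c,
      ρ.real ((fun b : S.ReducedAlphabet law i => S.proj j.2 b.1) ⁻¹' {c}) =
        marg (S.letter j) p c := by
    intro j c
    rw [hρdef, map_measureReal_apply hhm (MeasurableSet.of_discrete)]
    have h1 := sum_measureReal_singleton (μ := τ) (Finset.univ.filter fun a =>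
      S.proj j.2 (h a).1 = c)
    have h2 : (((Finset.univ.filter fun a => S.proj j.2 (h a).1 = c) : Finset (S.alphabet 0)) :
        Set (S.alphabet 0)) =
        h ⁻¹' ((fun b : S.ReducedAlphabet law i => S.proj j.2 b.1) ⁻¹' {c}) := by
      ext a; simp
    rw [h2] at h1
    rw [← h1, marg, Finset.sum_filter, Finset.sum_filter]
    refine Finset.sum_congr rfl fun a _ => ?_
    rw [hτp]
    by_cases ha : 0 < p a
    · have : S.proj j.2 (h a).1 = S.letter j a := by
        simp only [hh, ha, dif_pos]
        exact S.proj_letter _ _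
      rw [this]
    · have : p a = 0 := le_antisymm (not_lt.1 ha) (hp a)
      simp [this]
  have hint : ∫ x, θ * S.potential law i x ∂ν =
      ∑ a, p a * (θ * (S.γsum i * Real.log (S.meanCount law i (S.letter i a)))) := by
    have h1 := integral_comp_zero_infinitePi ρ (F := fun b : S.ReducedAlphabet law i =>
      θ * (S.γsum i * Real.log (S.meanCount law i b.1)))
      (Measurable.of_discrete).aestronglyMeasurable
    unfold potential
    rw [h1, hρdef, integral_map hhm.aemeasurable (Measurable.of_discrete).aestronglyMeasurable,
      integral_fintype Integrable.of_finite]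
    refine Finset.sum_congr rfl fun a _ => ?_
    rw [hτp, smul_eq_mul]
    by_cases ha : 0 < p a
    · simp [hh, ha]
    · have : p a = 0 := le_antisymm (not_lt.1 ha) (hp a)
      simp [this]
  have hent : ∀ j : {j : Fin (m + 1) // i ≤ j},
      -∑ a, p a * Real.log (marg (S.letter j) p (S.letter j a)) =
        ∑ c, Real.negMulLog (ρ.real
          ((fun b : S.ReducedAlphabet law i => S.proj j.2 b.1) ⁻¹' {c})) := by
    intro j
    rw [← sum_marg_mul (S.letter j) p fun c => Real.log (marg (S.letter j) p c),
      ← Finset.sum_neg_distrib]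
    refine Finset.sum_congr rfl fun c _ => ?_
    rw [hmarg, Real.negMulLog]
    ring
  have hγ : ∀ j, 0 ≤ S.γvec i j := fun j => by
    unfold γvec
    split_ifs
    · exact (S.γsum_pos i).le
    · exact S.γ_nonneg j
  have hlow : ((∑ j : {j : Fin (m + 1) // i ≤ j}, S.γvec i j *
      -∑ a, p a * Real.log (marg (S.letter j) p (S.letter j a)) : ℝ) : EReal) ≤
      S.weightedEntropy law i (S.γvec i) ν := by
    rw [ereal_coe_sum, weightedEntropy]
    refine Finset.sum_le_sum fun j _ => ?_
    rw [EReal.coe_mul, hent j]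
    refine mul_le_mul_of_nonneg_left ?_ (EReal.coe_nonneg.2 (hγ j))
    exact le_ksEntropy_map_infinitePi ρ (Measurable.of_discrete)
  have htsum : t = (∫ x, θ * S.potential law i x ∂ν) +
      ∑ j : {j : Fin (m + 1) // i ≤ j}, S.γvec i j *
        -∑ a, p a * Real.log (marg (S.letter j) p (S.letter j a)) := by
    have h1 : t = ∑ a, p a * t := by rw [← Finset.sum_mul, hp1, one_mul]
    have h2 : ∀ a, p a * t =
        p a * (θ * (S.γsum i * Real.log (S.meanCount law i (S.letter i a)))) -
        ∑ j : {j : Fin (m + 1) // i ≤ j}, S.γvec i j *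
          (p a * Real.log (marg (S.letter j) p (S.letter j a))) := by
      intro a
      rcases (hp a).eq_or_lt with h0 | h0
      · simp [← h0]
      · rw [← ht a h0, mul_sub, Finset.mul_sum]
        congr 1
        exact Finset.sum_congr rfl fun j _ => by ring
    rw [h1, hint, Finset.sum_congr rfl fun a _ => h2 a, Finset.sum_sub_distrib, Finset.sum_comm,
      sub_eq_add_neg, ← Finset.sum_neg_distrib]
    congr 1
    refine Finset.sum_congr rfl fun j _ => ?_
    rw [← Finset.mul_sum]
    ring
  rw [htsum, EReal.coe_add]
  refine le_trans (add_le_add le_rfl hlow) ?_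
  exact le_iSup_of_le ν (le_iSup_of_le inferInstance
    (le_iSup_of_le (measurePreserving_shift_infinitePi ρ) le_rfl))

/-- The function `θ ↦ P_i(θ)` is Lipschitz. -/
theorem exists_P_le_add (i : Fin (m + 1)) :
    ∃ C : ℝ, ∀ θ θ' : ℝ, S.P law i θ' ≤ S.P law i θ + ((C * |θ' - θ| : ℝ) : EReal) := by
  classical
  have : Fintype (S.ReducedAlphabet law i) := Fintype.ofFinite _
  set F : S.ReducedAlphabet law i → ℝ := fun b => S.γsum i * Real.log (S.meanCount law i b.1)
    with hF
  have hFC : ∀ b, |F b| ≤ ∑ b, |F b| := fun b =>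
    Finset.single_le_sum (f := fun b => |F b|) (fun _ _ => abs_nonneg _) (Finset.mem_univ b)
  refine ⟨∑ b, |F b|, fun θ θ' => ?_⟩
  set C := ∑ b, |F b|
  refine iSup_le fun ν => iSup_le fun hν => iSup_le fun hinv => ?_
  have hm : Measurable (S.potential law i) :=
    (Measurable.of_discrete (f := F)).comp (measurable_pi_apply 0)
  have hb : ∀ x, ‖S.potential law i x‖ ≤ C := fun x => hFC (x 0)
  have hi : Integrable (S.potential law i) ν :=
    Integrable.of_bound hm.aestronglyMeasurable C (Eventually.of_forall hb)
  have hle : (∫ x, θ' * S.potential law i x ∂ν) ≤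
      (∫ x, θ * S.potential law i x ∂ν) + C * |θ' - θ| := by
    rw [integral_const_mul, integral_const_mul]
    have h1 : |∫ x, S.potential law i x ∂ν| ≤ C := by
      have := norm_integral_le_of_norm_le_const (μ := ν) (Eventually.of_forall hb)
      simpa using this
    have h2 : (θ' - θ) * ∫ x, S.potential law i x ∂ν ≤ |θ' - θ| * C := by
      refine (le_abs_self _).trans ?_
      rw [abs_mul]
      exact mul_le_mul_of_nonneg_left h1 (abs_nonneg _)
    linarith
  calc ((∫ x, θ' * S.potential law i x ∂ν : ℝ) : EReal) + S.weightedEntropy law i (S.γvec i) ν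
      ≤ (((∫ x, θ * S.potential law i x ∂ν) + C * |θ' - θ| : ℝ) : EReal) +
          S.weightedEntropy law i (S.γvec i) ν := by
        gcongr
    _ = (((∫ x, θ * S.potential law i x ∂ν : ℝ) : EReal) +
          S.weightedEntropy law i (S.γvec i) ν) + ((C * |θ' - θ| : ℝ) : EReal) := by
        rw [EReal.coe_add, add_assoc, add_assoc, add_comm ((C * |θ' - θ| : ℝ) : EReal)]
    _ ≤ S.P law i θ + ((C * |θ' - θ| : ℝ) : EReal) := by
        gcongr
        exact le_iSup_of_le ν (le_iSup_of_le hν (le_iSup_of_le hinv le_rfl))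

end

end SelfAffineSystem

/-! ### Bounding Hausdorff measures by sets that cover infinitely often -/

/-- If every point of `K` belongs to selected sets of infinitely many generations, then the selected
sets of generation at least `N` cover `K` for every `N`. -/
theorem hausdorffMeasure_le_tsum_of_frequently_mem {X : Type*} [EMetricSpace X]
    [MeasurableSpace X] [BorelSpace X] {d : ℝ} (hd : 0 < d) {K : Set X} {ι : ℕ → Type*}
    [∀ n, Countable (ι n)] (G : ∀ n, Set (ι n)) (C : ∀ n, ι n → Set X) {r : ℕ → ENNReal}
    (hr : Antitone r) (hr0 : Tendsto r atTop (nhds 0))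
    (hC : ∀ n y, Metric.ediam (C n y) ≤ r n)
    (hK : ∀ x ∈ K, ∃ᶠ n in atTop, ∃ y ∈ G n, x ∈ C n y) :
    Measure.hausdorffMeasure d K ≤ ∑' n, ∑' y, (G n).indicator (fun _ => r n ^ d) y := by
  classical
  set t : ℕ → (Σ n, ι n) → Set X := fun N z => if N ≤ z.1 ∧ z.2 ∈ G z.1 then C z.1 z.2 else ∅
    with ht
  have h := Measure.hausdorffMeasure_le_liminf_tsum d K r hr0 t
    (Eventually.of_forall fun N z => by
      simp only [ht]
      split_ifs with hz
      · exact (hC _ _).trans (hr hz.1)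
      · simp)
    (Eventually.of_forall fun N x hx => by
      obtain ⟨n, hn, y, hy, hxy⟩ := frequently_atTop.1 (hK x hx) N
      exact Set.mem_iUnion.2 ⟨⟨n, y⟩, by simpa [ht, hn, hy] using hxy⟩)
  refine h.trans ?_
  rw [← ENNReal.tsum_sigma' fun z : Σ n, ι n => (G z.1).indicator (fun _ => r z.1 ^ d) z.2]
  refine (liminf_le_liminf (v := fun _ => ∑' z : Σ n, ι n,
    (G z.1).indicator (fun _ => r z.1 ^ d) z.2) (Eventually.of_forall fun N =>
    ENNReal.tsum_le_tsum fun z => ?_)).trans (liminf_const _).le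
  by_cases hz : z.2 ∈ G z.1
  · rw [Set.indicator_of_mem hz]
    refine ENNReal.rpow_le_rpow ?_ hd.le
    simp only [ht]
    split_ifs
    · exact hC _ _
    · simp
  · simp [ht, hz, ENNReal.zero_rpow_of_pos hd]

theorem prefixDist_le_exp {α : Type*} {c : ℝ} (hc : 0 < c) {x y : ℕ → α} {N : ℕ}
    (h : ∀ k < N, x k = y k) : prefixDist c x y ≤ Real.exp (-(N : ℝ) / c) := by
  unfold prefixDist
  split_ifs with hxy
  · positivity
  · have hN : N ≤ PiNat.firstDiff (E := fun _ => α) x y := by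
      by_contra! hlt
      exact PiNat.apply_firstDiff_ne (E := fun _ => α) hxy (h _ hlt)
    have : (N : ℝ) ≤ (PiNat.firstDiff (E := fun _ => α) x y : ℝ) := by exact_mod_cast hN
    gcongr

/-! ### Resolution of a position -/

/-- For lengths `ℓ 0 ≤ ℓ 1 ≤ ⋯ ≤ ℓ m`, the least index `j` with `k < ℓ j` (and `m` if there is
none): the position `k` of a sequence is recorded in the alphabet of this index. -/
def resolution {m : ℕ} (ℓ : Fin (m + 1) → ℕ) (k : ℕ) : Fin (m + 1) :=
  if h : (Finset.univ.filter fun j => k < ℓ j).Nonempty then Finset.min' _ h else Fin.last m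

section resolution

variable {m : ℕ} {ℓ : Fin (m + 1) → ℕ} {k : ℕ}

theorem resolution_le {j : Fin (m + 1)} (h : k < ℓ j) : resolution ℓ k ≤ j := by
  have hj : j ∈ Finset.univ.filter fun j => k < ℓ j := by simpa using h
  rw [resolution, dif_pos ⟨j, hj⟩]
  exact Finset.min'_le _ _ hj

theorem lt_resolution {j : Fin (m + 1)} (h : k < ℓ j) : k < ℓ (resolution ℓ k) := by
  have hj : j ∈ Finset.univ.filter fun j => k < ℓ j := by simpa using h
  rw [resolution, dif_pos ⟨j, hj⟩]
  exact (Finset.mem_filter.1 (Finset.min'_mem _ ⟨j, hj⟩)).2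

theorem resolution_eq {j : Fin (m + 1)} (h : k < ℓ j) (h' : ∀ i < j, ℓ i ≤ k) :
    resolution ℓ k = j := by
  refine (resolution_le h).eq_of_not_lt fun hlt => ?_
  exact absurd (h' _ hlt) (not_le.2 (lt_resolution h))

theorem resolution_eq_zero (h : k < ℓ 0) : resolution ℓ k = 0 :=
  resolution_eq h fun i hi => absurd hi (Fin.not_lt_zero i)

theorem sum_resolution (hℓ : Monotone ℓ) (F : Fin (m + 1) → ℕ → ℝ) :
    ∑ k ∈ Finset.range (ℓ (Fin.last m)), F (resolution ℓ k) k =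
      ∑ k ∈ Finset.range (ℓ 0), F 0 k +
        ∑ j : Fin m, ∑ k ∈ Finset.Ico (ℓ j.castSucc) (ℓ j.succ), F j.succ k := by
  rw [← Finset.sum_fiberwise (s := Finset.range (ℓ (Fin.last m))) (g := resolution ℓ),
    Fin.sum_univ_succ]
  congr 1
  · have : (Finset.range (ℓ (Fin.last m))).filter (fun k => resolution ℓ k = 0) =
        Finset.range (ℓ 0) := by
      ext k
      simp only [Finset.mem_filter, Finset.mem_range]
      constructor
      · rintro ⟨h1, h2⟩
        have := lt_resolution h1
        rwa [h2] at this
      · intro h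
        exact ⟨h.trans_le (hℓ (Fin.zero_le _)), resolution_eq_zero h⟩
    rw [this]
    refine Finset.sum_congr rfl fun k hk => ?_
    rw [resolution_eq_zero (Finset.mem_range.1 hk)]
  · refine Finset.sum_congr rfl fun j _ => ?_
    have hiff : ∀ k, k ∈ Finset.Ico (ℓ j.castSucc) (ℓ j.succ) →
        resolution ℓ k = j.succ := fun k hk => by
      rw [Finset.mem_Ico] at hk
      exact resolution_eq hk.2 fun i hi => (hℓ (Fin.le_castSucc_iff.2 hi)).trans hk.1
    have : (Finset.range (ℓ (Fin.last m))).filter (fun k => resolution ℓ k = j.succ) =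
        Finset.Ico (ℓ j.castSucc) (ℓ j.succ) := by
      ext k
      simp only [Finset.mem_filter, Finset.mem_range]
      constructor
      · rintro ⟨h1, h2⟩
        have h3 := lt_resolution h1
        rw [h2] at h3
        refine Finset.mem_Ico.2 ⟨not_lt.1 fun h4 => ?_, h3⟩
        have h5 := resolution_le h4
        rw [h2] at h5
        exact absurd h5 (not_le.2 (Fin.castSucc_lt_succ))
      · intro h
        exact ⟨(Finset.mem_Ico.1 h).2.trans_le (hℓ (Fin.le_last _)), hiff k h⟩
    rw [this]
    exact Finset.sum_congr rfl fun k hk => by rw [hiff k hk]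

end resolution

/-- The combinatorial heart of the upper bound. Here `lam j` stands for the logarithm of the
marginal weights, `φ` for the logarithm of the mean counts, and `lam 0 = lq + lam i - φ` says how
the weight on the finest alphabet is obtained. By the Euler–Lagrange equation `heq`, the
difference of the two sides is, up to `n t`, a combination of differences of block averages at
comparable scales, so it cannot be large for all large `n`. -/
theorem frequently_cell_weight_le {m : ℕ} {s : Fin (m + 1) → ℝ} (hs : Monotone s) (hs0 : 0 < s 0)
    (i : Fin (m + 1)) {θ θ' t C : ℝ} (ht : 0 ≤ t)
    (hθ : θ * s i = (1 - θ') * s 0 + θ' * s i) {φ lq : ℕ → ℝ} {lam : Fin (m + 1) → ℕ → ℝ}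
    (hφ : ∀ k, |φ k| ≤ C) (hlam : ∀ j k, |lam j k| ≤ C)
    (h0 : ∀ k, lam 0 k = lq k + lam i k - φ k)
    (heq : ∀ k, θ * s i * φ k - s 0 * lam i k -
      ∑ j : Fin m, (s j.succ - s j.castSucc) * lam j.succ k = t)
    {ε : ℝ} (hε : 0 < ε) :
    ∃ᶠ n : ℕ in atTop,
      ∑ k ∈ Finset.range ⌊s 0 * n⌋₊, lq k +
          θ' * ∑ k ∈ Finset.Ico ⌊s 0 * n⌋₊ ⌊s i * n⌋₊, φ k ≤
        n * (t + ε) + ∑ k ∈ Finset.range ⌊s (Fin.last m) * n⌋₊,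
          lam (resolution (fun j => ⌊s j * n⌋₊) k) k := by
  have hpos : ∀ j, 0 < s j := fun j => hs0.trans_le (hs (Fin.zero_le j))
  have hD := ((logAverageNull_blockAvg_sub hφ (hpos 0) (hpos i)).const_mul (θ' * s i)).add
    ((LogAverageNull.sum Finset.univ fun (j : Fin m) _ =>
      ((logAverageNull_blockAvg_sub (hlam j.succ) (hpos 0) (hpos j.succ)).const_mul (s j.succ)).add
      ((logAverageNull_blockAvg_sub (hlam j.succ) (hpos 0) (hpos j.castSucc)).const_mul
        (-s j.castSucc))).const_mul (-1))
  -- `n = 0` is excluded because the block averages divide by the length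
  refine ((hD.frequently_le hε).and_eventually (eventually_ge_atTop 1)).mono ?_
  rintro n ⟨hn, hn1⟩
  have hn0 : (0 : ℝ) < n := by exact_mod_cast hn1
  set ℓ : Fin (m + 1) → ℕ := fun j => ⌊s j * n⌋₊ with hℓ
  have hℓm : Monotone ℓ := fun a b hab => Nat.floor_le_floor (by have := hs hab; gcongr)
  have hbl : ∀ (a : ℕ → ℝ) j, blockAvg a (s j * n) =
      (∑ k ∈ Finset.range (ℓ j), a k) / (s j * n) := fun a j => rfl
  simp only [hbl] at hn
  rw [sum_resolution hℓm lam]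
  change ∑ k ∈ Finset.range (ℓ 0), lq k + θ' * ∑ k ∈ Finset.Ico (ℓ 0) (ℓ i), φ k ≤ _
  rw [Finset.sum_Ico_eq_sub _ (hℓm (Fin.zero_le i))]
  simp only [Finset.sum_Ico_eq_sub _ (hℓm (Fin.castSucc_le_succ _)), h0, Finset.sum_sub_distrib,
    Finset.sum_add_distrib]
  have hsum : θ * s i * ∑ k ∈ Finset.range (ℓ 0), φ k - s 0 * ∑ k ∈ Finset.range (ℓ 0), lam i k -
      ∑ j : Fin m, (s j.succ - s j.castSucc) * ∑ k ∈ Finset.range (ℓ 0), lam j.succ k =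
      ℓ 0 * t := by
    have : ∑ k ∈ Finset.range (ℓ 0), (θ * s i * φ k - s 0 * lam i k -
      ∑ j : Fin m, (s j.succ - s j.castSucc) * lam j.succ k) = ℓ 0 * t := by
      rw [Finset.sum_congr rfl fun k _ => heq k]
      simp
    rw [Finset.sum_sub_distrib, Finset.sum_sub_distrib, Finset.sum_comm] at this
    simpa only [Finset.mul_sum] using this
  have hℓt : (ℓ 0 : ℝ) * t / s 0 ≤ n * t := by
    rw [div_le_iff₀ hs0]
    have : (ℓ 0 : ℝ) ≤ s 0 * n := Nat.floor_le (by positivity)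
    nlinarith
  set Sφ := ∑ k ∈ Finset.range (ℓ 0), φ k
  set Sφi := ∑ k ∈ Finset.range (ℓ i), φ k
  set Si := ∑ k ∈ Finset.range (ℓ 0), lam i k
  set T : Fin m → ℝ := fun j => ∑ k ∈ Finset.range (ℓ 0), lam j.succ k with hT
  set U : Fin m → ℝ := fun j => ∑ k ∈ Finset.range (ℓ j.castSucc), lam j.succ k with hU
  set V : Fin m → ℝ := fun j => ∑ k ∈ Finset.range (ℓ j.succ), lam j.succ k with hV
  have e1 : n * (θ' * s i * (Sφi / (s i * n) - Sφ / (s 0 * n))) =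
      θ' * Sφi - θ' * s i * Sφ / s 0 := by
    have := hpos i
    field_simp
  have e2 : n * (-1 * ∑ j : Fin m, (s j.succ * (V j / (s j.succ * n) - T j / (s 0 * n)) +
      -s j.castSucc * (U j / (s j.castSucc * n) - T j / (s 0 * n)))) =
      -(∑ j, V j - ∑ j, U j) + (∑ j : Fin m, (s j.succ - s j.castSucc) * T j) / s 0 := by
    rw [neg_one_mul, mul_neg, Finset.mul_sum, Finset.sum_div, ← Finset.sum_sub_distrib,
      ← Finset.sum_neg_distrib, ← Finset.sum_neg_distrib, ← Finset.sum_add_distrib]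
    refine Finset.sum_congr rfl fun j _ => ?_
    have h1 := hpos j.succ
    have h2 := hpos j.castSucc
    field_simp
    ring
  have e3 := mul_le_mul_of_nonneg_left hn hn0.le
  rw [mul_add, e1, e2] at e3
  have e4 : (∑ j : Fin m, (s j.succ - s j.castSucc) * T j) =
      θ * s i * Sφ - s 0 * Si - ℓ 0 * t := by rw [← hsum]; ring
  rw [e4, hθ] at e3
  have e5 : θ' * Sφi - θ' * s i * Sφ / s 0 + (-(∑ j, V j - ∑ j, U j) +
      (((1 - θ') * s 0 + θ' * s i) * Sφ - s 0 * Si - ℓ 0 * t) / s 0) =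
      θ' * Sφi + (1 - θ') * Sφ - Si - (∑ j, V j - ∑ j, U j) - ℓ 0 * t / s 0 := by
    field_simp
    ring
  rw [e5] at e3
  linarith

namespace SelfAffineSystem

variable {m : ℕ} (S : SelfAffineSystem m)

/-! ### Survival probabilities of words and cells -/

theorem mem_spongeLevel_congr (c : List (S.alphabet 0) → S.alphabet 0 → Bool) {n : ℕ}
    {x y : S.Point} (h : ∀ k < n, x k = y k) :
    x ∈ S.spongeLevel c n ↔ y ∈ S.spongeLevel c n := by
  refine forall₂_congr fun k hk => ?_
  have : (fun j : Fin k => x j) = fun j : Fin k => y j :=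
    funext fun j => h j (j.2.trans hk)
  rw [this, h k hk]

/-- Extension of a finite word by an arbitrary letter. -/
def extendWord (a₀ : S.alphabet 0) {n : ℕ} (w : Fin n → S.alphabet 0) : S.Point :=
  fun k => if h : k < n then w ⟨k, h⟩ else a₀

/-- The event that the cell of words `x` with `e k (x k) = y k` for all `k < n` meets `K_n`. -/
def cellMeets {n : ℕ} {E : Fin n → Type*} (e : ∀ k, S.alphabet 0 → E k) (y : ∀ k, E k)
    (c : List (S.alphabet 0) → S.alphabet 0 → Bool) : Prop :=
  ∃ x ∈ S.spongeLevel c n, ∀ k : Fin n, e k (x k) = y k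

open scoped Classical in
theorem setOf_cellMeets_eq {Ω : Type*} (c : List (S.alphabet 0) → Ω → S.alphabet 0 → Bool)
    (a₀ : S.alphabet 0) {n : ℕ} {E : Fin n → Type*} (e : ∀ k, S.alphabet 0 → E k)
    (y : ∀ k, E k) :
    {ω | S.cellMeets e y fun u => c u ω} =
      ⋃ w ∈ Fintype.piFinset fun k => Finset.univ.filter fun a => e k a = y k,
        {ω | S.extendWord a₀ w ∈ S.spongeLevel (fun u => c u ω) n} := by
  ext ω
  simp only [Set.mem_ofPred_eq, Set.mem_iUnion, Fintype.mem_piFinset, Finset.mem_filter,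
    Finset.mem_univ, true_and, exists_prop, cellMeets]
  constructor
  · rintro ⟨x, hx, hxy⟩
    refine ⟨fun k => x k, hxy, (S.mem_spongeLevel_congr _ fun k hk => ?_).1 hx⟩
    simp [extendWord, hk]
  · rintro ⟨w, hw, h⟩
    exact ⟨_, h, fun k => by simpa [extendWord] using hw k⟩

section survival

variable {Ω : Type*} [MeasurableSpace Ω] {Pr : Measure Ω}
  {law : Measure (S.alphabet 0 → Bool)} {c : List (S.alphabet 0) → Ω → S.alphabet 0 → Bool}

theorem measure_apply_eq_true [IsFiniteMeasure law] (hc_law : ∀ u, HasLaw (c u) law Pr)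
    (u : List (S.alphabet 0)) (a : S.alphabet 0) :
    Pr {ω | c u ω a = true} = ENNReal.ofReal (S.occProb law a) := by
  have := (hc_law u).measure_eq (p := fun A => A a = true)
    ((measurableSet_singleton true).preimage (measurable_pi_apply a))
  rw [this, occProb, ofReal_measureReal]

theorem nullMeasurableSet_mem_spongeLevel (hc_law : ∀ u, HasLaw (c u) law Pr) (x : S.Point)
    (n : ℕ) : NullMeasurableSet {ω | x ∈ S.spongeLevel (fun u => c u ω) n} Pr := by
  have : {ω | x ∈ S.spongeLevel (fun u => c u ω) n} = ⋂ (k : ℕ) (_ : k < n),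
      c (List.ofFn fun j : Fin k => x j) ⁻¹' {A | A (x k) = true} := by
    ext ω
    simp [spongeLevel]
  rw [this]
  refine NullMeasurableSet.iInter fun k => NullMeasurableSet.iInter fun _ => ?_
  exact (hc_law _).aemeasurable.nullMeasurableSet_preimage
    ((measurableSet_singleton true).preimage (measurable_pi_apply (x k)))

/-- The events `x_{k+1} ∈ A(x_1 ⋯ x_k)` along one sequence involve distinct words, hence are
independent. -/
theorem measure_mem_spongeLevel [IsFiniteMeasure law] (hc_law : ∀ u, HasLaw (c u) law Pr)
    (hc_indep : iIndepFun c Pr) (x : S.Point) (n : ℕ) :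
    Pr {ω | x ∈ S.spongeLevel (fun u => c u ω) n} =
      ∏ k ∈ Finset.range n, ENNReal.ofReal (S.occProb law (x k)) := by
  classical
  set u : ℕ → List (S.alphabet 0) := fun k => List.ofFn fun j : Fin k => x j with hu
  have hlen : ∀ k, (u k).length = k := fun k => by simp [hu]
  have hinj : Function.Injective u := fun k l h => by rw [← hlen k, h, hlen]
  have h1 : {ω | x ∈ S.spongeLevel (fun u => c u ω) n} =
      ⋂ v ∈ (Finset.range n).image u, c v ⁻¹' {A | A (x v.length) = true} := by
    ext ω
    simp [spongeLevel, hu]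
  rw [h1, hc_indep.measure_inter_preimage_eq_mul ((Finset.range n).image u)
    (sets := fun v => {A | A (x v.length) = true}) fun v _ =>
    (measurableSet_singleton true).preimage (measurable_pi_apply (x v.length)),
    Finset.prod_image hinj.injOn]
  refine Finset.prod_congr rfl fun k _ => ?_
  rw [hlen]
  exact S.measure_apply_eq_true hc_law (u k) (x k)

theorem nullMeasurableSet_cellMeets (hc_law : ∀ u, HasLaw (c u) law Pr) {n : ℕ}
    {E : Fin n → Type*} (e : ∀ k, S.alphabet 0 → E k) (y : ∀ k, E k) :
    NullMeasurableSet {ω | S.cellMeets e y fun u => c u ω} Pr := by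
  classical
  have : Nonempty (S.alphabet 0) :=
    (Nat.card_pos_iff.1 (lt_of_lt_of_le two_pos (S.two_le_card 0))).1
  rw [S.setOf_cellMeets_eq c (Classical.arbitrary _)]
  exact Finset.nullMeasurableSet_biUnion _ fun w _ =>
    S.nullMeasurableSet_mem_spongeLevel hc_law _ _

theorem measure_cellMeets_le [IsFiniteMeasure law] (hc_law : ∀ u, HasLaw (c u) law Pr)
    (hc_indep : iIndepFun c Pr) {n : ℕ} {E : Fin n → Type*} (e : ∀ k, S.alphabet 0 → E k)
    (y : ∀ k, E k) :
    Pr {ω | S.cellMeets e y fun u => c u ω} ≤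
      ENNReal.ofReal (∏ k, marg (e k) (S.occProb law) (y k)) := by
  classical
  have : Nonempty (S.alphabet 0) :=
    (Nat.card_pos_iff.1 (lt_of_lt_of_le two_pos (S.two_le_card 0))).1
  rw [S.setOf_cellMeets_eq c (Classical.arbitrary _)]
  refine (measure_biUnion_finset_le _ _).trans (le_of_eq ?_)
  simp only [marg]
  rw [Finset.prod_univ_sum, ENNReal.ofReal_sum_of_nonneg fun w _ =>
    Finset.prod_nonneg fun k _ => S.occProb_nonneg law _]
  refine Finset.sum_congr rfl fun w _ => ?_
  rw [S.measure_mem_spongeLevel hc_law hc_indep, Finset.prod_range,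
    ENNReal.ofReal_prod_of_nonneg fun k _ => S.occProb_nonneg law _]
  refine Finset.prod_congr rfl fun k _ => ?_
  simp [extendWord]

/-- Letters of probability zero almost surely do not occur in `K`, so that all logarithms along
its points are genuine. -/
theorem ae_forall_occProb_pos [IsFiniteMeasure law] (hc_law : ∀ u, HasLaw (c u) law Pr) :
    ∀ᵐ ω ∂Pr, ∀ x ∈ S.sponge fun u => c u ω, ∀ k, 0 < S.occProb law (x k) := by
  have h : ∀ᵐ ω ∂Pr, ∀ (u : List (S.alphabet 0)) (a : S.alphabet 0), S.occProb law a = 0 →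
      ¬ c u ω a = true := by
    rw [ae_all_iff]
    intro u
    rw [ae_all_iff]
    intro a
    by_cases ha : S.occProb law a = 0
    · have h0 := S.measure_apply_eq_true hc_law u a
      rw [ha, ENNReal.ofReal_zero] at h0
      filter_upwards [measure_eq_zero_iff_ae_notMem.1 h0] with ω hω _ using hω
    · exact Eventually.of_forall fun ω h => absurd h ha
  filter_upwards [h] with ω hω x hx k
  refine (S.occProb_nonneg law _).lt_of_ne fun h0 => hω (List.ofFn fun j : Fin k => x j) (x k) h0.symm ?_
  exact (Set.mem_iInter₂.1 hx (k + 1) (by omega)) k (by omega)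

end survival

/-! ### Cells of the self-affine metric -/

/-- The scales attached to the pair of levels `i.castSucc`, `i.succ`: all levels up to
`i.castSucc` are given the scale of `i.castSucc`, the higher ones keep their own. -/
def scale (i : Fin m) (j : Fin (m + 1)) : ℝ := S.γsum (max i.castSucc j)

theorem γsum_mono : Monotone S.γsum := fun _ _ hij =>
  Finset.sum_le_sum_of_subset_of_nonneg (Finset.Iic_subset_Iic.2 hij) fun j _ _ => S.γ_nonneg j

theorem γsum_succ (j : Fin m) : S.γsum j.succ = S.γsum j.castSucc + S.γ j.succ := by
  have : Finset.Iic j.succ = insert j.succ (Finset.Iic j.castSucc) := by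
    ext x
    simp only [Finset.mem_Iic, Finset.mem_insert, Fin.le_def, Fin.ext_iff, Fin.val_castSucc,
      Fin.val_succ]
    omega
  rw [γsum, this, Finset.sum_insert (by simp), add_comm]
  rfl

theorem scale_mono (i : Fin m) : Monotone (S.scale i) := fun _ _ h =>
  S.γsum_mono (max_le_max le_rfl h)

theorem scale_zero (i : Fin m) : S.scale i 0 = S.γsum i.castSucc := by
  simp [scale]

theorem scale_succ_self (i : Fin m) : S.scale i i.succ = S.γsum i.succ := by
  rw [scale, max_eq_right (Fin.castSucc_le_succ i)]

theorem γsum_le_scale (i : Fin m) (j : Fin (m + 1)) : S.γsum j ≤ S.scale i j :=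
  S.γsum_mono (le_max_right _ _)

theorem scale_succ_sub (i j : Fin m) :
    S.scale i j.succ - S.scale i j.castSucc = if i.succ ≤ j.succ then S.γ j.succ else 0 := by
  split_ifs with h
  · have h1 : i.castSucc ≤ j.castSucc := by simpa using h
    rw [scale, scale, max_eq_right (h1.trans (Fin.castSucc_le_succ j)), max_eq_right h1, γsum_succ]
    ring
  · have h1 : j.succ ≤ i.castSucc := Fin.le_castSucc_iff.2 (not_le.1 h)
    rw [scale, scale, max_eq_left h1, max_eq_left ((Fin.castSucc_le_succ j).trans h1), sub_self]

/-- The length of the prefix recorded in the alphabet of index `j` by the cells of generation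
`n`. -/
def cellLength (i : Fin m) (n : ℕ) (j : Fin (m + 1)) : ℕ := ⌊S.scale i j * n⌋₊

theorem cellLength_mono (i : Fin m) (n : ℕ) : Monotone (S.cellLength i n) := fun _ _ h =>
  Nat.floor_le_floor (mul_le_mul_of_nonneg_right (S.scale_mono i h) n.cast_nonneg)

/-- The alphabet index recorded at position `k` by the cells of generation `n`. -/
abbrev cellRes (i : Fin m) (n k : ℕ) : Fin (m + 1) := resolution (S.cellLength i n) k

/-- The cells of generation `n`: approximate balls of radius `e^{-n}`, refined to full
information on the prefix of length about `(γ_1 + ⋯ + γ_{i-1}) n`. -/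
abbrev Cell (i : Fin m) (n : ℕ) : Type _ :=
  ∀ k : Fin (S.cellLength i n (Fin.last m)), S.alphabet (S.cellRes i n k)

/-- The cell of generation `n` that contains `x`. -/
def cellOf (i : Fin m) (n : ℕ) (x : S.Point) : S.Cell i n := fun k => S.letter _ (x k)

/-- The rounding of the lengths costs the constant `e^{1 / γ_1}`. -/
theorem ediam_cell_le (i : Fin m) (n : ℕ) (y : S.Cell i n) :
    Metric.ediam {x : S.Point | S.cellOf i n x = y} ≤
      ENNReal.ofReal (Real.exp (1 / S.γ 0 - n)) := by
  refine Metric.ediam_le fun x hx x' hx' => ?_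
  rw [edist_dist]
  refine ENNReal.ofReal_le_ofReal ?_
  change S.pointDist x x' ≤ _
  refine Finset.sup'_le _ _ fun l _ => ?_
  have hγ := S.γsum_pos l
  have hγ0 := S.γ_zero_pos
  have hγl : S.γ 0 ≤ S.γsum l := by
    have h := S.γsum_mono (Fin.zero_le l)
    have h0 : S.γsum 0 = S.γ 0 := by
      have : Finset.Iic (0 : Fin (m + 1)) = {0} := by ext x; simp
      rw [γsum, this, Finset.sum_singleton]
    linarith
  refine (prefixDist_le_exp hγ (N := ⌊S.γsum l * n⌋₊) fun k hk => ?_).trans ?_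
  · have hk1 : k < S.cellLength i n l := hk.trans_le (Nat.floor_le_floor
      (mul_le_mul_of_nonneg_right (S.γsum_le_scale i l) n.cast_nonneg))
    have hk2 : k < S.cellLength i n (Fin.last m) :=
      hk1.trans_le (S.cellLength_mono i n (Fin.le_last l))
    have h1 : S.letter (S.cellRes i n k) (x k) = S.letter (S.cellRes i n k) (x' k) :=
      congrFun ((show S.cellOf i n x = y from hx).trans
        (show S.cellOf i n x' = y from hx').symm) ⟨k, hk2⟩
    change S.letter l (x k) = S.letter l (x' k)
    rw [← S.proj_letter (resolution_le hk1), h1, S.proj_letter]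
  · rw [Real.exp_le_exp]
    have h1 := Nat.lt_floor_add_one (S.γsum l * n)
    have h2 : 1 / S.γsum l ≤ 1 / S.γ 0 := one_div_le_one_div_of_le hγ0 hγl
    have h3 : -(⌊S.γsum l * n⌋₊ : ℝ) / S.γsum l ≤ 1 / S.γsum l - n := by
      rw [div_le_iff₀ hγ]
      field_simp
      linarith
    linarith

/-! ### Cell weights and good cells -/

theorem sum_scale_sub_mul (i : Fin m) (f : Fin (m + 1) → ℝ) :
    ∑ j : Fin m, (S.scale i j.succ - S.scale i j.castSucc) * f j.succ =
      ∑ l ∈ Finset.Ici i.succ, S.γ l * f l := by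
  have h : ∑ l : Fin (m + 1), (if i.succ ≤ l then S.γ l * f l else 0) =
      ∑ l ∈ Finset.Ici i.succ, S.γ l * f l := by
    rw [← Finset.sum_filter]
    congr 1
    ext l; simp
  rw [← h, Fin.sum_univ_succ, if_neg (by simp), zero_add]
  refine Finset.sum_congr rfl fun j _ => ?_
  rw [scale_succ_sub]
  split_ifs <;> simp

theorem sum_Ici_eq (i : Fin (m + 1)) (f : Fin (m + 1) → ℝ) :
    ∑ l ∈ Finset.Ici i, f l = f i + ∑ l ∈ Finset.Ioi i, f l := by
  rw [← Finset.Ioi_insert, Finset.sum_insert (by simp)]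

theorem sum_γvec_mul (i : Fin (m + 1)) (f : Fin (m + 1) → ℝ) :
    ∑ j : {j : Fin (m + 1) // i ≤ j}, S.γvec i j * f j =
      S.γsum i * f i + ∑ l ∈ Finset.Ioi i, S.γ l * f l := by
  rw [← Finset.sum_subtype (Finset.Ici i) (fun x => Finset.mem_Ici) fun j => S.γvec i j * f j,
    sum_Ici_eq]
  congr 1
  · simp [γvec]
  · refine Finset.sum_congr rfl fun l hl => ?_
    rw [γvec, if_neg (Finset.mem_Ioi.1 hl).ne']

/-- Restriction of a cell to the prefix of length `S.cellLength i n j`. -/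
def cellPrefix (i : Fin m) (n : ℕ) (j : Fin (m + 1)) (y : S.Cell i n)
    (k : Fin (S.cellLength i n j)) : S.alphabet (S.cellRes i n k) :=
  y ⟨k, k.2.trans_le (S.cellLength_mono i n (Fin.le_last j))⟩

/-- The product of the marginals of the weight `q` over the prefix of length
`S.cellLength i n j` of a cell. -/
def cellWeight (q : S.alphabet 0 → ℝ) (i : Fin m) (n : ℕ) (j : Fin (m + 1)) (y : S.Cell i n) : ℝ :=
  ∏ k : Fin (S.cellLength i n j), marg (S.letter (S.cellRes i n k)) q (S.cellPrefix i n j y k)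

theorem cellWeight_nonneg {q : S.alphabet 0 → ℝ} (hq : ∀ a, 0 ≤ q a) (i : Fin m) (n : ℕ)
    (j : Fin (m + 1)) (y : S.Cell i n) : 0 ≤ S.cellWeight q i n j y :=
  Finset.prod_nonneg fun _ _ => marg_nonneg _ hq _

theorem sum_cellWeight_last {p : S.alphabet 0 → ℝ} (hp : ∑ a, p a = 1) (i : Fin m) (n : ℕ) :
    ∑ y, S.cellWeight p i n (Fin.last m) y = 1 := by
  classical
  have h := Finset.prod_univ_sum (fun k : Fin (S.cellLength i n (Fin.last m)) =>
    (Finset.univ : Finset (S.alphabet (S.cellRes i n k))))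
    fun k b => marg (S.letter (S.cellRes i n k)) p b
  rw [Fintype.piFinset_univ] at h
  refine (h.symm.trans ?_)
  simp [sum_marg, hp]

theorem cellWeight_cellOf (q : S.alphabet 0 → ℝ) (i : Fin m) (n : ℕ) (j : Fin (m + 1))
    (x : ℕ → S.alphabet 0) : S.cellWeight q i n j (S.cellOf i n x) =
      ∏ k ∈ Finset.range (S.cellLength i n j),
        marg (S.letter (S.cellRes i n k)) q (S.letter (S.cellRes i n k) (x k)) :=
  (Finset.prod_range fun k =>
    marg (S.letter (S.cellRes i n k)) q (S.letter (S.cellRes i n k) (x k))).symm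

/-- The cells of generation `n` whose survival probability, estimated by interpolating with the
exponent `θ'` between the mean counts for two prefix lengths, is at most `e^{n B}` times their
mass for the Bernoulli weight `p`. -/
def goodCells (q p : S.alphabet 0 → ℝ) (i : Fin m) (θ' B : ℝ) (n : ℕ) : Set (S.Cell i n) :=
  {y | S.cellWeight q i n 0 y ^ (1 - θ') * S.cellWeight q i n i.succ y ^ θ' ≤
    Real.exp (n * B) * S.cellWeight p i n (Fin.last m) y}

/-- A point whose letters all have positive probability lies in good cells of infinitely many
generations; these are the generations selected by `frequently_cell_weight_le`. -/
theorem frequently_cellOf_mem_goodCells {q p : S.alphabet 0 → ℝ} (hq : ∀ a, 0 ≤ q a)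
    (hp : ∀ a, 0 ≤ p a) (hqp : ∀ a, 0 < q a → 0 < p a) (i : Fin m) {θ θ' t : ℝ} (ht : 0 ≤ t)
    (hθ : θ * S.γsum i.succ = (1 - θ') * S.γsum i.castSucc + θ' * S.γsum i.succ)
    (hcond : ∀ a, p a * marg (S.letter i.succ) q (S.letter i.succ a) =
      q a * marg (S.letter i.succ) p (S.letter i.succ a))
    (heq : ∀ a, 0 < q a →
      θ * (S.γsum i.succ * Real.log (marg (S.letter i.succ) q (S.letter i.succ a))) -
        S.γsum i.succ * Real.log (marg (S.letter i.succ) p (S.letter i.succ a)) -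
        ∑ l ∈ Finset.Ioi i.succ, S.γ l * Real.log (marg (S.letter l) p (S.letter l a)) = t)
    {ε : ℝ} (hε : 0 < ε) {x : ℕ → S.alphabet 0} (hx : ∀ k, 0 < q (x k)) :
    ∃ᶠ n in atTop, S.cellOf i n x ∈ S.goodCells q p i θ' (t + ε) n := by
  set Φ : S.alphabet 0 → ℝ := fun a => Real.log (marg (S.letter i.succ) q (S.letter i.succ a))
    with hΦ
  set Λ : Fin (m + 1) → S.alphabet 0 → ℝ := fun j a =>
    Real.log (marg (S.letter j) p (S.letter j a)) with hΛ
  have hinj : Function.Injective (S.letter 0) := fun a b h => by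
    rwa [S.letter_zero, S.letter_zero] at h
  have hC1 : ∀ a, |Φ a| ≤ ∑ a, |Φ a| + ∑ j, ∑ a, |Λ j a| := fun a => by
    have h1 := Finset.single_le_sum (f := fun a => |Φ a|) (fun _ _ => abs_nonneg _)
      (Finset.mem_univ a)
    have h2 : 0 ≤ ∑ j, ∑ a, |Λ j a| :=
      Finset.sum_nonneg fun _ _ => Finset.sum_nonneg fun _ _ => abs_nonneg _
    linarith
  have hC2 : ∀ j a, |Λ j a| ≤ ∑ a, |Φ a| + ∑ j, ∑ a, |Λ j a| := fun j a => by
    have h1 := Finset.single_le_sum (f := fun a => |Λ j a|) (fun _ _ => abs_nonneg _)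
      (Finset.mem_univ a)
    have h2 := Finset.single_le_sum (f := fun j => ∑ a, |Λ j a|)
      (fun _ _ => Finset.sum_nonneg fun _ _ => abs_nonneg _) (Finset.mem_univ j)
    have h3 : 0 ≤ ∑ a, |Φ a| := Finset.sum_nonneg fun _ _ => abs_nonneg _
    linarith
  have hfreq := frequently_cell_weight_le (s := S.scale i) (S.scale_mono i)
    (by rw [scale_zero]; exact S.γsum_pos _) i.succ ht
    (by rw [scale_succ_self, scale_zero]; exact hθ)
    (φ := fun k => Φ (x k)) (lq := fun k => Real.log (q (x k))) (lam := fun j k => Λ j (x k))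
    (fun k => hC1 (x k)) (fun j k => hC2 j (x k))
    (fun k => by
      have h1 := marg_pos (S.letter i.succ) hq (hx k)
      have h2 := marg_pos (S.letter i.succ) hp (hqp _ (hx k))
      have h3 : p (x k) = q (x k) * marg (S.letter i.succ) p (S.letter i.succ (x k)) /
          marg (S.letter i.succ) q (S.letter i.succ (x k)) := by
        rw [eq_div_iff h1.ne']; exact hcond (x k)
      simp only [hΛ, hΦ]
      rw [marg_of_injective _ hinj, h3, Real.log_div (mul_pos (hx k) h2).ne' h1.ne',
        Real.log_mul (hx k).ne' h2.ne'])
    (fun k => by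
      rw [S.sum_scale_sub_mul i fun j => Λ j (x k), sum_Ici_eq, scale_zero, scale_succ_self,
        ← heq (x k) (hx k), γsum_succ]
      simp only [hΛ, hΦ]
      ring)
    hε
  refine hfreq.mono fun n hn => ?_
  change ∑ k ∈ Finset.range (S.cellLength i n 0), Real.log (q (x k)) +
    θ' * ∑ k ∈ Finset.Ico (S.cellLength i n 0) (S.cellLength i n i.succ), Φ (x k) ≤
    n * (t + ε) + ∑ k ∈ Finset.range (S.cellLength i n (Fin.last m)),
      Λ (S.cellRes i n k) (x k) at hn
  have hU0 : S.cellWeight q i n 0 (S.cellOf i n x) =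
      Real.exp (∑ k ∈ Finset.range (S.cellLength i n 0), Real.log (q (x k))) := by
    rw [cellWeight_cellOf, Real.exp_sum]
    refine Finset.prod_congr rfl fun k hk => ?_
    have hres : S.cellRes i n k = 0 := resolution_eq_zero (Finset.mem_range.1 hk)
    rw [Real.exp_log (hx k), hres, marg_of_injective _ hinj]
  have hUi : S.cellWeight q i n i.succ (S.cellOf i n x) =
      Real.exp (∑ k ∈ Finset.range (S.cellLength i n 0), Real.log (q (x k)) +
        ∑ k ∈ Finset.Ico (S.cellLength i n 0) (S.cellLength i n i.succ), Φ (x k)) := by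
    rw [Real.exp_add, ← hU0, cellWeight_cellOf, cellWeight_cellOf,
      ← Finset.prod_range_mul_prod_Ico _ (S.cellLength_mono i n (Fin.zero_le i.succ)),
      Real.exp_sum]
    congr 1
    refine Finset.prod_congr rfl fun k hk => ?_
    rw [Finset.mem_Ico] at hk
    have hres : S.cellRes i n k = i.succ := by
      refine resolution_eq hk.2 fun j hj => le_trans (le_of_eq ?_) hk.1
      have h1 : S.scale i j = S.scale i 0 := by
        rw [scale_zero, scale, max_eq_left (Fin.le_castSucc_iff.2 hj)]
      rw [cellLength, cellLength, h1]
    rw [hres, Real.exp_log (marg_pos _ hq (hx k))]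
  have hP : S.cellWeight p i n (Fin.last m) (S.cellOf i n x) =
      Real.exp (∑ k ∈ Finset.range (S.cellLength i n (Fin.last m)),
        Λ (S.cellRes i n k) (x k)) := by
    rw [cellWeight_cellOf, Real.exp_sum]
    refine Finset.prod_congr rfl fun k _ => ?_
    rw [Real.exp_log (marg_pos _ hp (hqp _ (hx k)))]
  rw [goodCells, Set.mem_ofPred_eq, hU0, hUi, hP, ← Real.exp_mul, ← Real.exp_mul, ← Real.exp_add, ← Real.exp_add,
    Real.exp_le_exp]
  refine le_trans (le_of_eq ?_) hn
  ring

/-! ### First moment of the number of good cells -/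

section random

variable {Ω : Type*} [MeasurableSpace Ω] {Pr : Measure Ω} [IsProbabilityMeasure Pr]
  {law : Measure (S.alphabet 0 → Bool)} [IsProbabilityMeasure law]
  {c : List (S.alphabet 0) → Ω → S.alphabet 0 → Bool}

/-- The event that the cell `y` is met by `K` up to the lengths of its two distinguished
prefixes. -/
def cellEvent (c : List (S.alphabet 0) → Ω → S.alphabet 0 → Bool) (i : Fin m) (n : ℕ)
    (y : S.Cell i n) : Set Ω :=
  {ω | S.cellMeets (fun k => S.letter (S.cellRes i n k)) (S.cellPrefix i n 0 y) fun u => c u ω} ∩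
  {ω | S.cellMeets (fun k => S.letter (S.cellRes i n k)) (S.cellPrefix i n i.succ y)
    fun u => c u ω}

/-- The interpolation that brings in the parameter `θ`: a probability bounded by `U` and by `V`
is bounded by `U ^ (1 - θ') * V ^ θ'`. -/
theorem measure_cellEvent_le (hc_law : ∀ u, HasLaw (c u) law Pr)
    (hc_indep : iIndepFun c Pr) (i : Fin m) (n : ℕ) (y : S.Cell i n) {θ' : ℝ} (h0 : 0 ≤ θ')
    (h1 : θ' ≤ 1) :
    Pr (S.cellEvent c i n y) ≤ ENNReal.ofReal
      (S.cellWeight (S.occProb law) i n 0 y ^ (1 - θ') *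
        S.cellWeight (S.occProb law) i n i.succ y ^ θ') := by
  have hle : ∀ j, Pr {ω | S.cellMeets (fun k => S.letter (S.cellRes i n k))
      (S.cellPrefix i n j y) fun u => c u ω} ≤
        ENNReal.ofReal (S.cellWeight (S.occProb law) i n j y) := fun j =>
    S.measure_cellMeets_le hc_law hc_indep _ _
  have hnn := fun j => S.cellWeight_nonneg (S.occProb_nonneg law) i n j y
  have hreal : ∀ j, Pr (S.cellEvent c i n y) ≤
      ENNReal.ofReal (S.cellWeight (S.occProb law) i n j y) →
      Pr.real (S.cellEvent c i n y) ≤ S.cellWeight (S.occProb law) i n j y := fun j h =>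
    ENNReal.toReal_le_of_le_ofReal (hnn j) h
  have hU := hreal 0 ((measure_mono Set.inter_subset_left).trans (hle 0))
  have hV := hreal i.succ ((measure_mono Set.inter_subset_right).trans (hle i.succ))
  rw [← ofReal_measureReal (μ := Pr)]
  refine ENNReal.ofReal_le_ofReal ?_
  rcases (measureReal_nonneg (μ := Pr) (s := S.cellEvent c i n y)).eq_or_lt with h | h
  · rw [← h]
    exact mul_nonneg (Real.rpow_nonneg (hnn _) _) (Real.rpow_nonneg (hnn _) _)
  · calc Pr.real (S.cellEvent c i n y)
        = Pr.real (S.cellEvent c i n y) ^ (1 - θ') * Pr.real (S.cellEvent c i n y) ^ θ' := by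
          rw [← Real.rpow_add h]; simp
      _ ≤ _ := mul_le_mul (Real.rpow_le_rpow h.le hU (by linarith)) (Real.rpow_le_rpow h.le hV h0)
          (Real.rpow_nonneg h.le _) (Real.rpow_nonneg (hnn _) _)

/-- First moment estimate: the expected number of good cells of generation `n` that are met is at
most `e^{n (t + ε)}`, because their Bernoulli masses sum to at most `1`. -/
theorem ae_tsum_goodCells_lt_top (hc_law : ∀ u, HasLaw (c u) law Pr)
    (hc_indep : iIndepFun c Pr) {p : S.alphabet 0 → ℝ} (hp : ∀ a, 0 ≤ p a)
    (hp1 : ∑ a, p a = 1) (i : Fin m) {θ' t ε : ℝ} (h0 : 0 ≤ θ') (h1 : θ' ≤ 1) (hε : 0 < ε) :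
    ∀ᵐ ω ∂Pr, ∑' n, ∑' y, {y | y ∈ S.goodCells (S.occProb law) p i θ' (t + ε) n ∧
      ω ∈ S.cellEvent c i n y}.indicator
        (fun _ => ENNReal.ofReal (Real.exp (1 / S.γ 0 - n)) ^ (t + 2 * ε)) y < ⊤ := by
  classical
  set d := t + 2 * ε
  set r : ℕ → ENNReal := fun n => ENNReal.ofReal (Real.exp (1 / S.γ 0 - n)) ^ d with hr
  set G : ∀ n, Set (S.Cell i n) := S.goodCells (S.occProb law) p i θ' (t + ε) with hG
  set F : ∀ n, S.Cell i n → Ω → ENNReal := fun n y =>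
    {ω | y ∈ G n ∧ ω ∈ S.cellEvent c i n y}.indicator fun _ => r n with hF
  have hswap : ∀ ω, ∑' n, ∑' y, {y | y ∈ G n ∧ ω ∈ S.cellEvent c i n y}.indicator
      (fun _ => r n) y = ∑' n, ∑' y, F n y ω := fun ω => rfl
  have hmeas : ∀ n y, NullMeasurableSet {ω | y ∈ G n ∧ ω ∈ S.cellEvent c i n y} Pr := by
    intro n y
    by_cases hy : y ∈ G n
    · simp only [hy, true_and]
      exact (S.nullMeasurableSet_cellMeets hc_law _ _).inter
        (S.nullMeasurableSet_cellMeets hc_law _ _)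
    · simp [hy]
  have hFm : ∀ n y, AEMeasurable (F n y) Pr := fun n y =>
    aemeasurable_const.indicator₀ (hmeas n y)
  have hn : ∀ n, ∑' y, ∫⁻ ω, F n y ω ∂Pr ≤
      ENNReal.ofReal (Real.exp (d / S.γ 0) * Real.exp (-ε) ^ n) := by
    intro n
    have hy : ∀ y, ∫⁻ ω, F n y ω ∂Pr ≤ r n * (ENNReal.ofReal (Real.exp (n * (t + ε))) *
        ENNReal.ofReal (S.cellWeight p i n (Fin.last m) y)) := by
      intro y
      rw [hF, lintegral_indicator_const₀ (hmeas n y)]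
      gcongr
      by_cases hy : y ∈ G n
      · simp only [hy, true_and]
        rw [← ENNReal.ofReal_mul (Real.exp_pos _).le]
        exact (S.measure_cellEvent_le hc_law hc_indep i n y h0 h1).trans
          (ENNReal.ofReal_le_ofReal hy)
      · simp [hy]
    rw [tsum_fintype]
    refine (Finset.sum_le_sum fun y _ => hy y).trans (le_of_eq ?_)
    rw [← Finset.mul_sum, ← Finset.mul_sum, ← ENNReal.ofReal_sum_of_nonneg fun y _ =>
      S.cellWeight_nonneg hp i n _ y, S.sum_cellWeight_last hp1, ENNReal.ofReal_one, mul_one, hr]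
    simp only
    rw [ENNReal.ofReal_rpow_of_pos (Real.exp_pos _), ← ENNReal.ofReal_mul (by positivity),
      ← Real.exp_mul, ← Real.exp_add, ← Real.exp_nat_mul, ← Real.exp_add]
    congr 2
    ring
  have hfin : ∫⁻ ω, ∑' n, ∑' y, F n y ω ∂Pr ≠ ⊤ := by
    rw [lintegral_tsum fun n => AEMeasurable.tsum fun y => hFm n y]
    simp only [lintegral_tsum fun y => hFm _ y]
    refine ne_top_of_le_ne_top ?_ (ENNReal.tsum_le_tsum hn)
    refine Summable.tsum_ofReal_ne_top
      ((summable_geometric_of_lt_one (Real.exp_pos _).le ?_).mul_left _)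
    rw [Real.exp_lt_one_iff]
    linarith
  exact ae_lt_top' (AEMeasurable.tsum fun n => AEMeasurable.tsum fun y => hFm n y)
    hfin

end random

/-! ### The upper bound -/

/-- The constant of the Euler–Lagrange equation is nonnegative: otherwise every mean count would
be at most the weight of the letter, contradicting that the total mean exceeds `1`. -/
theorem equilibrium_nonneg {q p : S.alphabet 0 → ℝ} (hq : ∀ a, 0 ≤ q a) (hq1 : 1 < ∑ a, q a)
    (hp : ∀ a, 0 ≤ p a) (hqp : ∀ a, 0 < q a → 0 < p a) (hp1 : ∑ a, p a = 1)
    (i : Fin (m + 1)) {θ t : ℝ} (hθ0 : 0 < θ) (hθ1 : θ ≤ 1)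
    (heq : ∀ a, 0 < q a →
      θ * (S.γsum i * Real.log (marg (S.letter i) q (S.letter i a))) -
        S.γsum i * Real.log (marg (S.letter i) p (S.letter i a)) -
        ∑ l ∈ Finset.Ioi i, S.γ l * Real.log (marg (S.letter l) p (S.letter l a)) = t) :
    0 ≤ t := by
  by_contra! ht
  have hle1 : ∀ l b, marg (S.letter l) p b ≤ 1 := fun l b => by
    rw [← hp1, ← sum_marg (S.letter l) p]
    exact Finset.single_le_sum (f := marg (S.letter l) p) (fun c _ => marg_nonneg _ hp c)
      (Finset.mem_univ b)
  have hγ := S.γsum_pos i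
  have key : ∀ b, marg (S.letter i) q b ≤ marg (S.letter i) p b := by
    intro b
    rcases (marg_nonneg (S.letter i) hq b).eq_or_lt with h0 | h0
    · rw [← h0]; exact marg_nonneg _ hp b
    obtain ⟨a, rfl, ha⟩ := exists_of_marg_pos _ h0
    have hpa := marg_pos (S.letter i) hp (hqp a ha)
    have h1 : ∑ l ∈ Finset.Ioi i, S.γ l * Real.log (marg (S.letter l) p (S.letter l a)) ≤ 0 :=
      Finset.sum_nonpos fun l _ => mul_nonpos_of_nonneg_of_nonpos (S.γ_nonneg l)
        (Real.log_nonpos (marg_nonneg _ hp _) (hle1 _ _))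
    have h2 := heq a ha
    set x := Real.log (marg (S.letter i) q (S.letter i a))
    set y := Real.log (marg (S.letter i) p (S.letter i a)) with hy
    have hy0 : y ≤ 0 := Real.log_nonpos hpa.le (hle1 _ _)
    have h3 : S.γsum i * (θ * x - y) < 0 := by linarith
    have h4 : θ * x < y := by
      by_contra! h
      have := mul_nonneg hγ.le (sub_nonneg.2 h)
      linarith
    have h5 : x ≤ y := by
      have h6 : x < 0 := by
        by_contra! h
        have := mul_nonneg hθ0.le h
        linarith
      nlinarith
    exact (Real.log_le_log_iff h0 hpa).1 h5
  have := Finset.sum_le_sum fun b (_ : b ∈ Finset.univ) => key b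
  rw [sum_marg, sum_marg, hp1] at this
  linarith

section random

variable {Ω : Type*} [MeasurableSpace Ω] {Pr : Measure Ω} [IsProbabilityMeasure Pr]
  {law : Measure (S.alphabet 0 → Bool)} [IsProbabilityMeasure law]
  {c : List (S.alphabet 0) → Ω → S.alphabet 0 → Bool}

/-- The bound for one level and one exponent: the equilibrium constant `t` satisfies
`t ≤ P_i(θ)`, and the good cells show that the dimension is at most `t`. -/
theorem ae_dimH_le (hc_law : ∀ u, HasLaw (c u) law Pr) (hc_indep : iIndepFun c Pr)
    (hq1 : 1 < ∑ a, S.occProb law a) (i : Fin m) (hi : 0 < S.γ i.succ) {θ : ℝ}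
    (hθ : θ ∈ Set.Icc (S.thetaTilde i.succ) 1) :
    ∀ᵐ ω ∂Pr, ((dimH (S.sponge fun u => c u ω) : ENNReal) : EReal) ≤ S.P law i.succ θ := by
  set q := S.occProb law with hqdef
  have hq := S.occProb_nonneg law
  have hqpos : ∃ a, 0 < q a := by
    by_contra! h
    have := Finset.sum_nonpos fun a (_ : a ∈ Finset.univ) => h a
    linarith
  have hs1 := S.γsum_pos i.castSucc
  have hs2 := S.γsum_pos i.succ
  have hs := S.γsum_succ i
  have htilde : S.thetaTilde i.succ = S.γsum i.castSucc / S.γsum i.succ := by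
    rw [thetaTilde, γsum]
    congr 2
  rw [htilde] at hθ
  have hθ1 : S.γsum i.castSucc ≤ θ * S.γsum i.succ := (div_le_iff₀ hs2).1 hθ.1
  have hθ0 : 0 < θ := (div_pos hs1 hs2).trans_le hθ.1
  -- `θ'` is the position of `θ γsum i.succ` between `γsum i.castSucc` and `γsum i.succ`
  set θ' := (θ * S.γsum i.succ - S.γsum i.castSucc) / S.γ i.succ with hθ'
  have hθ'eq : θ' * S.γ i.succ = θ * S.γsum i.succ - S.γsum i.castSucc :=
    div_mul_cancel₀ _ hi.ne'
  have hθθ' : θ * S.γsum i.succ = (1 - θ') * S.γsum i.castSucc + θ' * S.γsum i.succ := by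
    rw [hs] at hθ'eq ⊢
    linarith
  have h0 : 0 ≤ θ' := div_nonneg (by linarith) hi.le
  have h1 : θ' ≤ 1 := by
    rw [hθ', div_le_one hi]
    nlinarith [hθ.2]
  obtain ⟨p, t, hp, hp0, hp1, hcond, heq⟩ := exists_equilibrium S.letter
    (fun j a a' h => by rw [letter_succ, letter_succ, h]) S.γ S.γ_nonneg i.succ q hq hqpos
    (fun b => θ * (S.γsum i.succ * Real.log (marg (S.letter i.succ) q b))) (S.γsum i.succ) hs2
  have hpn : ∀ a, 0 ≤ p a := fun a => by
    rcases (hq a).eq_or_lt with h | h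
    · exact (hp0 a h.symm).ge
    · exact (hp a h).le
  have hpq : ∀ a, 0 < p a → 0 < q a := fun a ha =>
    (hq a).lt_of_ne fun h => ha.ne' (hp0 a h.symm)
  have ht : 0 ≤ t := S.equilibrium_nonneg hq hq1 hpn hp hp1 i.succ hθ0 hθ.2 heq
  have htP : (t : EReal) ≤ S.P law i.succ θ := by
    refine S.le_P_of_equilibrium law i.succ θ t hpn hp1 hpq fun a ha => ?_
    rw [S.sum_γvec_mul i.succ fun j => Real.log (marg (S.letter j) p (S.letter j a)),
      ← heq a (hpq a ha), meanCount_eq]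
    ring
  have hsum : ∀ᵐ ω ∂Pr, ∀ N : ℕ, ∑' n, ∑' y, {y | y ∈ S.goodCells q p i θ'
      (t + 1 / ((N : ℝ) + 1)) n ∧ ω ∈ S.cellEvent c i n y}.indicator
        (fun _ => ENNReal.ofReal (Real.exp (1 / S.γ 0 - n)) ^ (t + 2 * (1 / ((N : ℝ) + 1)))) y
          < ⊤ :=
    ae_all_iff.2 fun N => S.ae_tsum_goodCells_lt_top hc_law hc_indep hpn hp1 i h0 h1
      Nat.one_div_pos_of_nat
  filter_upwards [hsum, S.ae_forall_occProb_pos hc_law] with ω hω hωq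
  have hdim : ∀ N : ℕ, dimH (S.sponge fun u => c u ω) ≤
      ENNReal.ofReal (t + 2 * (1 / ((N : ℝ) + 1))) := by
    intro N
    have hε : 0 < 1 / ((N : ℝ) + 1) := Nat.one_div_pos_of_nat
    set ε := 1 / ((N : ℝ) + 1)
    have hd : 0 < t + 2 * ε := by linarith
    borelize S.Point
    refine dimH_le_of_hausdorffMeasure_ne_top ?_
    rw [Real.coe_toNNReal _ hd.le]
    refine ne_top_of_le_ne_top (hω N).ne (hausdorffMeasure_le_tsum_of_frequently_mem hd
      (fun n => {y | y ∈ S.goodCells q p i θ' (t + ε) n ∧ ω ∈ S.cellEvent c i n y})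
      (fun n y => {x : S.Point | S.cellOf i n x = y}) ?_ ?_ (S.ediam_cell_le i) ?_)
    · intro a b hab
      refine ENNReal.ofReal_le_ofReal (Real.exp_le_exp.2 ?_)
      have : (a : ℝ) ≤ b := by exact_mod_cast hab
      linarith
    · rw [← ENNReal.ofReal_zero]
      refine ENNReal.tendsto_ofReal (Real.tendsto_exp_atBot.comp ?_)
      exact tendsto_atBot_add_const_left _ _
        (tendsto_neg_atTop_atBot.comp tendsto_natCast_atTop_atTop)
    · intro x hx
      have hlevel : ∀ N, x ∈ S.spongeLevel (fun u => c u ω) N := fun N k hk =>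
        (Set.mem_iInter₂.1 hx (k + 1) (by omega)) k (by omega)
      refine (S.frequently_cellOf_mem_goodCells hq hpn hp i ht hθθ' hcond heq hε
        (hωq x hx)).mono fun n hn => ⟨S.cellOf i n x, ⟨hn, ?_, ?_⟩, rfl⟩
      · exact ⟨x, hlevel _, fun k => rfl⟩
      · exact ⟨x, hlevel _, fun k => rfl⟩
  have hlim : dimH (S.sponge fun u => c u ω) ≤ ENNReal.ofReal t := by
    have h2 : Tendsto (fun N : ℕ => ENNReal.ofReal (t + 2 * (1 / ((N : ℝ) + 1)))) atTop
        (nhds (ENNReal.ofReal (t + 2 * 0))) :=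
      ENNReal.tendsto_ofReal (tendsto_const_nhds.add
        (tendsto_one_div_add_atTop_nhds_zero_nat.const_mul 2))
    rw [mul_zero, add_zero] at h2
    exact ge_of_tendsto' h2 hdim
  refine le_trans ?_ htP
  refine (EReal.coe_ennreal_le_coe_ennreal_iff.2 hlim).trans (le_of_eq ?_)
  rw [EReal.coe_ennreal_ofReal, max_eq_left ht]

end random

end SelfAffineSystem

end

theorem theorem4p6 {m : ℕ} (hm : 1 ≤ m) (S : SelfAffineSystem m)
    {Ω : Type*} [MeasurableSpace Ω] (Pr : Measure Ω) [IsProbabilityMeasure Pr]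
    (law : Measure (S.alphabet 0 → Bool))
    (c : List (S.alphabet 0) → Ω → S.alphabet 0 → Bool)
    (hc_law : ∀ u, HasLaw (c u) law Pr)
    (hc_indep : iIndepFun c Pr)
    (hmean : 1 < ∫ A, ({a | A a = true}.ncard : ℝ) ∂law) :
    ∀ᵐ ω ∂Pr, (S.sponge fun u => c u ω).Nonempty →
      ((dimH (S.sponge fun u => c u ω) : ENNReal) : EReal) ≤
        ⨅ i ∈ S.activeLevels, ⨅ θ ∈ Set.Icc (S.thetaTilde i) 1, S.P law i θ := by
  have hlaw : IsProbabilityMeasure law := (hc_law []).isProbabilityMeasure_iff.1 inferInstance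
  have hq1 : 1 < ∑ a, S.occProb law a := by
    have h := S.integral_ncard law fun _ => True
    simp only [and_true, Finset.filter_true] at h
    rwa [← h]
  -- a countable dense set of exponents suffices, as `P` is Lipschitz in the exponent
  have hdense : ∀ i : Fin m, ∃ D : Set ℝ, D ⊆ Set.Icc (S.thetaTilde i.succ) 1 ∧ D.Countable ∧
      Set.Icc (S.thetaTilde i.succ) 1 ⊆ closure D := fun i =>
    (TopologicalSpace.IsSeparable.of_separableSpace _).exists_countable_dense_subset
  choose D hDs hDc hDd using hdense
  have hae : ∀ᵐ ω ∂Pr, ∀ i : Fin m, 0 < S.γ i.succ → ∀ θ ∈ D i,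
      ((dimH (S.sponge fun u => c u ω) : ENNReal) : EReal) ≤ S.P law i.succ θ := by
    rw [ae_all_iff]
    intro i
    by_cases hi : 0 < S.γ i.succ
    · have := (ae_ball_iff (hDc i)).2 fun θ hθ =>
        S.ae_dimH_le hc_law hc_indep hq1 i hi (hDs i hθ)
      filter_upwards [this] with ω hω _ using hω
    · exact Eventually.of_forall fun ω h => absurd h hi
  filter_upwards [hae] with ω hω _
  refine le_iInf₂ fun i hi => le_iInf₂ fun θ hθ => ?_
  obtain ⟨i, rfl⟩ := Fin.exists_succ_eq.2 hi.1.ne'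
  obtain ⟨C, hC⟩ := S.exists_P_le_add law i.succ
  refine EReal.le_of_forall_lt_iff_le.1 fun z hz => ?_
  obtain ⟨w, hw, hwz⟩ := EReal.lt_iff_exists_real_btwn.1 hz
  rw [EReal.coe_lt_coe_iff] at hwz
  obtain ⟨u, huD, hu⟩ := mem_closure_iff_seq_limit.1 (hDd i hθ)
  have hlim : Tendsto (fun n => w + C * |u n - θ|) atTop (nhds w) := by
    have h1 := ((hu.sub_const θ).abs.const_mul C).const_add w
    rwa [sub_self, abs_zero, mul_zero, add_zero] at h1
  obtain ⟨n, hn⟩ := (hlim.eventually (gt_mem_nhds hwz)).exists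
  calc ((dimH (S.sponge fun u => c u ω) : ENNReal) : EReal)
      ≤ S.P law i.succ (u n) := hω i hi.2 (u n) (huD n)
    _ ≤ S.P law i.succ θ + ((C * |u n - θ| : ℝ) : EReal) := hC θ (u n)
    _ ≤ (w : EReal) + ((C * |u n - θ| : ℝ) : EReal) := add_le_add hw.le le_rfl
    _ ≤ z := by
        rw [← EReal.coe_add, EReal.coe_le_coe_iff]
        exact hn.le
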